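/- Let $q$ be an odd prime power and let $h$ be an even positive integer with $\frac{q-1}{h}=2\tau+1$ for some integer $\tau\ge 1$. Let $r\geq 1$ be an integer, put $m=\frac{q^2-1}{2h}$ and $n=rm+1$, let $\theta$ be a primitive element of $\mathbb F_{q^2}$, and let $\gamma=\theta^{2h}$, which has order $m$. An $[[n,\kappa,d]]_q$ quantum code is a subspace $Q$ of $(\mathbb C^q)^{\otimes n}$ of dimension $q^\kappa$ with minimum distance $d$: if $P$ denotes the orthogonal projection onto $Q$, then $d$ is the least number of tensor factors on which an operator $E$ with $PEP\notin\mathbb C P$ can act. It is a quantum MDS code if $2d=n-\kappa+2$. 1. If $\frac h2+1\le r\le h$, then for every integer $k$ with $1\le k\le (h+1)\frac{q-1}{2h}+\frac12$ there exists an $[[n,n-2k,k+1]]_q$ quantum MDS code. 2. If $r$ is odd and $h<r<2h$, then for every integer $k$ with $1\le k\le r\frac{q-1}{2h}+\frac12$ there exists an $[[n,n-2k,k+1]]_q$ quantum MDS code. Moreover, in both cases the quantum code can be obtained by the Hermitian construction from a generalized Reed–Solomon code $GRS_k(\boldsymbol a,\boldsymbol v)=\{(v_1f(a_1),\dots,v_nf(a_n)):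 f\in\mathbb F_{q^2}[x],\ \deg f\le k-1\}$ with all $v_j\ne0$ that is Hermitian self-orthogonal (that is, $\sum_{j}x_jy_j^q=0$ for all its codewords $x,y$), and whose distinct locators $a_1,\dots,a_n$ are the elements of $\{0\}\cup\bigcup_{l=1}^{r}\theta^{i_l}\langle\gamma\rangle$ for some integers $i_1,\dots,i_r$ distinct modulo $2h$. Here a quantum code is obtained by the Hermitian construction from a linear code $C\subseteq\mathbb F_{q^2}^n$ if, for some $\mathbb F_q$-basis $(e_0,e_1)$ of $\mathbb F_{q^2}$ and some nontrivial additive character $\psi$ of $\mathbb F_q$, it is a nonzero common eigenspace of the operators $|x\rangle\mapsto\psi\big(t\cdot(x+s)\big)\,|x+s\rangle$ ($x\in\mathbb F_q^n$), where $(s,t)$ runs over the pairs in $\mathbb F_q^n\times\mathbb F_q^n$ with $e_0s+e_1t\in C$. -/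

import Mathlib

noncomputable section

/-! ### Quantum codes -/

/-- The Hilbert space `(ℂ^q)^{⊗ n}` of `n` qudits, with orthonormal basis `|x⟩`, `x ∈ Aⁿ`,
where the alphabet `A` has `q` elements. -/
abbrev QuditSpace (A : Type*) [Fintype A] (n : ℕ) : Type _ := EuclideanSpace ℂ (Fin n → A)

/-- An operator on `n` qudits, given by its matrix in the basis `|x⟩`. -/
abbrev QuditOp (A : Type*) (n : ℕ) : Type _ := Matrix (Fin n → A) (Fin n → A) ℂ

/-- The operator `E` acts only on the qudits in `S`: it has the form `M ⊗ 1`, where `M` is an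
arbitrary operator on the qudits in `S` and `1` is the identity on the other qudits. -/
def QuditOp.ActsOn {A : Type*} {n : ℕ} (E : QuditOp A n) (S : Finset (Fin n)) : Prop :=
  ∃ M : Matrix (S → A) (S → A) ℂ,
    (∀ x y : Fin n → A, (∀ i, i ∉ S → x i = y i) →
      E x y = M (fun i => x i.1) (fun i => y i.1)) ∧
    (∀ x y : Fin n → A, ¬ (∀ i, i ∉ S → x i = y i) → E x y = 0)

/-- The code `Q` detects the error `E`: `P E P = c P` for some scalar `c`, where `P` is the
orthogonal projection onto `Q` (the Knill–Laflamme condition). -/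
def Detects {A : Type*} [Fintype A] {n : ℕ} (Q : Submodule ℂ (QuditSpace A n))
    (E : QuditOp A n) : Prop :=
  ∃ c : ℂ, ∀ u ∈ Q, ∀ v ∈ Q,
    inner ℂ u (WithLp.toLp 2 (E.mulVec v.ofLp) : QuditSpace A n) = c * inner ℂ u v

/-- `d` is the minimum distance of `Q`: the least number of qudits on which an error that `Q`
does not detect can act. (This is the notion for codes of dimension at least two; a
one-dimensional code detects every error.) -/
def HasMinDistance {A : Type*} [Fintype A] {n : ℕ} (Q : Submodule ℂ (QuditSpace A n))
    (d : ℕ) : Prop :=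
  IsLeast {w : ℕ | ∃ (S : Finset (Fin n)) (E : QuditOp A n),
    S.card = w ∧ E.ActsOn S ∧ ¬ Detects Q E} d

/-- `Q` is an `[[n, κ, d]]_q` quantum code, with `q` the size of the alphabet: a subspace of
dimension `q ^ κ` of the space of `n` qudits, of minimum distance `d`. -/
structure IsQuantumCode {A : Type*} [Fintype A] {n : ℕ} (Q : Submodule ℂ (QuditSpace A n))
    (κ d : ℕ) : Prop where
  finrank_eq : Module.finrank ℂ Q = Fintype.card A ^ κ
  minDistance : HasMinDistance Q d

/-- `Q` is an `[[n, κ, d]]_q` quantum MDS code: it attains the quantum Singleton bound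
`2 d ≤ n - κ + 2`. -/
structure IsQuantumMDSCode {A : Type*} [Fintype A] {n : ℕ} (Q : Submodule ℂ (QuditSpace A n))
    (κ d : ℕ) : Prop extends IsQuantumCode Q κ d where
  singleton_eq : 2 * d + κ = n + 2

/-! ### Generalized Reed–Solomon codes and Hermitian self-orthogonality -/

/-- The Hermitian inner product `∑ xᵢ yᵢ^q`. -/
def hermInner {K : Type*} [Field K] {n : ℕ} (q : ℕ) (x y : Fin n → K) : K :=
  ∑ i, x i * y i ^ q

/-- The Hermitian dual of a linear code, as a set. -/
def hermDual {K : Type*} [Field K] {n : ℕ} (q : ℕ) (C : Submodule K (Fin n → K)) :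
    Set (Fin n → K) :=
  {x | ∀ y ∈ C, hermInner q x y = 0}

/-- `C` is Hermitian self-orthogonal. -/
def IsHermSelfOrthogonal {K : Type*} [Field K] {n : ℕ} (q : ℕ)
    (C : Submodule K (Fin n → K)) : Prop :=
  (C : Set (Fin n → K)) ⊆ hermDual q C

/-- The code `GRS_k(a, v)` of all `(v₁ f(a₁), …, vₙ f(aₙ))` with `deg f ≤ k - 1`. -/
def grsCode {K : Type*} [Field K] {n : ℕ} (k : ℕ) (a v : Fin n → K) :
    Submodule K (Fin n → K) :=
  (Polynomial.degreeLT K k).map (LinearMap.pi fun i => v i • Polynomial.leval (a i))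

/-! ### The Hermitian construction -/

/-- The error operator `Z(w₁) X(w₀)` on `n` qudits with alphabet `F`, where
`X(s)|x⟩ = |x + s⟩`, `Z(t)|x⟩ = ψ(t · x)|x⟩`, and `w₀, w₁ ∈ Fⁿ` are the coordinate vectors of
`w ∈ Kⁿ` in the `F`-basis `b` of `K`. -/
def weylOp {F K : Type*} [Field F] [Fintype F] [Field K] [Algebra F K] {n : ℕ}
    (b : Module.Basis (Fin 2) F K) (ψ : AddChar F ℂ) (w : Fin n → K)
    (φ : QuditSpace F n) : QuditSpace F n :=
  WithLp.toLp 2 fun x : Fin n → F =>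
    ψ (∑ i, b.repr (w i) 1 * x i) * φ (x - fun i => b.repr (w i) 0)

/-- `Q` is a stabilizer code that the Hermitian construction yields from the linear code `C`
over the quadratic extension `K` of `F`: a nonzero common eigenspace of the error operators
that belong to the codewords of `C`, under an identification of `K` with `F²` by an `F`-basis
and with a nontrivial additive character of `F`. -/
def IsHermitianConstruction {F K : Type*} [Field F] [Fintype F] [Field K] [Algebra F K] {n : ℕ}
    (C : Submodule K (Fin n → K)) (Q : Submodule ℂ (QuditSpace F n)) : Prop :=
  Q ≠ ⊥ ∧ ∃ (b : Module.Basis (Fin 2) F K) (ψ : AddChar F ℂ) (c : (Fin n → K) → ℂ),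
    ψ ≠ 1 ∧ ∀ φ : QuditSpace F n, φ ∈ Q ↔ ∀ w ∈ C, weylOp b ψ w φ = c w • φ

/-- There is an `[[n, n - 2k, k + 1]]_q` quantum MDS code, where `q = |F|`, that the Hermitian
construction yields from a Hermitian self-orthogonal code `GRS_k(a, v)` whose locators are `0`
and the elements of `r` distinct cosets `θ^{i_l} ⟨γ⟩`, with `γ = θ^{2h}`.
The Singleton equality in `IsQuantumMDSCode` forces `n - 2 * k` to be the true difference. -/
def ExistsQuantumMDSFromGRS (F : Type*) {K : Type*} [Field F] [Fintype F] [Field K] [Algebra F K]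
    (θ : Kˣ) (h r n k : ℕ) : Prop :=
  ∃ (e : Fin r → ℕ) (a v : Fin n → K) (Q : Submodule ℂ (QuditSpace F n)),
    (∀ l l' : Fin r, e l ≡ e l' [MOD 2 * h] → l = l') ∧
    Function.Injective a ∧
    Set.range a = {0} ∪ {x : K | ∃ (l : Fin r) (ν : ℕ), x = θ ^ e l * (θ ^ (2 * h)) ^ ν} ∧
    (∀ i, v i ≠ 0) ∧
    IsHermSelfOrthogonal (Fintype.card F) (grsCode k a v) ∧
    IsHermitianConstruction (grsCode k a v) Q ∧
    IsQuantumMDSCode Q (n - 2 * k) (k + 1)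

end

/-! A Hermitian self-orthogonal code `C` gives commuting Weyl operators, hence a stabilizer code of
dimension `q ^ n / |C|`. Any error is a combination of Weyl operators on the same qudits. Those
outside the symplectic complement of `C` move the code to its orthogonal complement, and by
`K`-linearity this complement is the Hermitian dual. So the distance is the dual distance once a
minimum-weight dual word lies outside `C`. For `GRS_k` with `2k < n` that distance is `k + 1` by
Lagrange interpolation (`exists_quantumMDS_of_grsCode`).

It remains to make `∑ v_i^(q+1) a_i^(s+qt)` vanish for `s, t < k`. Since the norm to `F` is
surjective, `v_i^(q+1)` may be any nonzero element of `F`; it is taken to be a constant `w_l` on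
each coset. A coset sum vanishes unless `s + qt = mT`, and the weight of the locator `0` settles `T
= 0`. With `ω = θ^m`, what remains is `∑ w_l ω^(e_l T) = 0` for the occurring `T ≠ 0`, together with
`∑ w_l ≠ 0` (`existsQuantumMDSFromGRS_of_weights`).

Write `h = 2g`, `c = 2τ + 1`, so that `q = 2gc + 1` and `m = c(gc + 1)`. Then `ζ = ω²` is a
primitive `2g`-th root of unity in `F`, and base-`q` digits determine the possible `T`
(`exponent_cases`). In the first range only even `T` occur, and Lagrange weights on the nodes `ζ^l`
suffice. In the second range all `2g` even exponents `e_l` are used, along with an odd number of odd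
ones. The sum becomes `V(T) + ω^T U(T)` with `V, U` in `F`; Lagrange weights control `U`, and
Fourier inversion then prescribes `V`. -/

/-! ### The symplectic form -/

section Symplectic

open Finset

variable {F K : Type*} [Field F] [Field K] [Algebra F K] {n : ℕ} (b : Module.Basis (Fin 2) F K)

/-- The symplectic form on `Kⁿ ≃ F²ⁿ` that describes the commutation of Weyl operators. -/
noncomputable def symplForm (w w' : Fin n → K) : F :=
  ∑ i, (b.repr (w i) 0 * b.repr (w' i) 1 - b.repr (w i) 1 * b.repr (w' i) 0)

lemma symplForm_smul_right (a : F) (w w' : Fin n → K) :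
    symplForm b w (a • w') = a * symplForm b w w' := by
  simp only [symplForm, mul_sum, Pi.smul_apply, map_smul, Finsupp.smul_apply, smul_eq_mul]
  exact sum_congr rfl fun i _ => by ring

end Symplectic

/-! ### Weyl operators -/

section Weyl

open Finset

variable {F K : Type*} [Field F] [Fintype F] [Field K] [Algebra F K] {n : ℕ}

/-- Orthogonality of the characters `y ↦ ψ (t · y)` of `F^ι`. -/
lemma sum_addChar_dot {ι : Type*} [Fintype ι] [DecidableEq ι] {ψ : AddChar F ℂ}
    (hψ : ψ ≠ 1) (y : ι → F) [Decidable (y = 0)] :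
    ∑ t : ι → F, ψ (∑ i, t i * y i) =
      if y = 0 then (Fintype.card F : ℂ) ^ Fintype.card ι else 0 := by
  classical
  split_ifs with hy
  · subst hy
    simp
  · let χ : AddChar (ι → F) ℂ :=
      { toFun := fun t => ψ (∑ i, t i * y i)
        map_zero_eq_one' := by simp
        map_add_eq_mul' := fun s t => by
          simp only [Pi.add_apply, add_mul, sum_add_distrib, AddChar.map_add_eq_mul] }
    refine AddChar.sum_eq_zero_of_ne_one (ψ := χ) fun hχ => hψ ?_
    obtain ⟨i, hi⟩ := Function.ne_iff.1 hy
    ext a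
    have := DFunLike.congr_fun hχ (Pi.single i (a / y i))
    have h2 : ∑ j, Pi.single (M := fun _ => F) i (a / y i) j * y j = a := by
      rw [Finset.sum_eq_single i]
      · have hi' : y i ≠ 0 := hi
        simp [hi']
      · intro j _ hj
        simp [Pi.single_eq_of_ne hj]
      · simp
    change ψ (∑ j, Pi.single (M := fun _ => F) i (a / y i) j * y j) = 1 at this
    rwa [h2] at this

variable (b : Module.Basis (Fin 2) F K) (ψ : AddChar F ℂ)

/-- The operator `weylOp` as a linear map. -/
noncomputable def weylLin (w : Fin n → K) : QuditSpace F n →ₗ[ℂ] QuditSpace F n where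
  toFun := weylOp b ψ w
  map_add' φ φ' := by
    ext x
    simp [weylOp, mul_add]
  map_smul' c φ := by
    ext x
    simp [weylOp, mul_left_comm]

lemma weylLin_apply (w : Fin n → K) (φ : QuditSpace F n) (x : Fin n → F) :
    weylLin b ψ w φ x = ψ (∑ i, b.repr (w i) 1 * x i) * φ (x - fun i => b.repr (w i) 0) := rfl

lemma weylLin_zero : weylLin b ψ (0 : Fin n → K) = LinearMap.id := by
  ext φ x
  have : (x - fun _ => 0) = x := sub_zero x
  simp [weylLin_apply, this]

lemma weylLin_mul (w w' : Fin n → K) :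
    weylLin b ψ w * weylLin b ψ w' =
      ψ (-∑ i, b.repr (w' i) 1 * b.repr (w i) 0) • weylLin b ψ (w + w') := by
  refine LinearMap.ext fun φ => PiLp.ext fun x => ?_
  simp only [Module.End.mul_apply, weylLin_apply, LinearMap.smul_apply, PiLp.smul_apply, smul_eq_mul,
    Pi.add_apply, map_add, Finsupp.add_apply, Pi.sub_apply]
  rw [← mul_assoc, ← mul_assoc, ← AddChar.map_add_eq_mul, ← AddChar.map_add_eq_mul, sub_sub]
  congr 2
  · rw [← sum_add_distrib, ← sum_neg_distrib, ← sum_add_distrib]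
    exact sum_congr rfl fun i _ => by ring

lemma weylLin_mul_comm (w w' : Fin n → K) :
    weylLin b ψ w * weylLin b ψ w' =
      ψ (-symplForm b w w') • (weylLin b ψ w' * weylLin b ψ w) := by
  rw [weylLin_mul, weylLin_mul, smul_smul, add_comm w', ← AddChar.map_add_eq_mul]
  congr 2
  rw [symplForm, ← sum_neg_distrib, ← sum_neg_distrib, ← sum_neg_distrib, ← sum_add_distrib]
  exact sum_congr rfl fun i _ => by ring

lemma inner_weylLin_weylLin (w : Fin n → K) (u v : QuditSpace F n) :
    inner ℂ (weylLin b ψ w u) (weylLin b ψ w v) = inner ℂ u v := by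
  simp only [PiLp.inner_apply, weylLin_apply]
  refine (Equiv.sum_comp (Equiv.subRight fun i => b.repr (w i) 0) (fun y => inner ℂ (u y) (v y)) ▸ ?_)
  refine sum_congr rfl fun x _ => ?_
  simp only [RCLike.inner_apply, map_mul, Equiv.subRight_apply]
  rw [← AddChar.map_neg_eq_conj]
  have := AddChar.map_add_eq_mul ψ (-∑ i, b.repr (w i) 1 * x i) (∑ i, b.repr (w i) 1 * x i)
  rw [neg_add_cancel, AddChar.map_zero_eq_one] at this
  linear_combination (-(v (x - fun i => b.repr (w i) 0)) *
    (starRingEnd ℂ) (u (x - fun i => b.repr (w i) 0))) * this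

lemma weylLin_injective (w : Fin n → K) : Function.Injective (weylLin b ψ w) := by
  rw [injective_iff_map_eq_zero]
  intro u hu
  have := inner_weylLin_weylLin b ψ w u u
  rwa [hu, inner_zero_left, eq_comm, inner_self_eq_zero] at this

variable {ψ}

/-- A nonzero shift leaves the diagonal empty; without a shift, the diagonal is a nontrivial
character of `F^n`, which sums to zero. -/
lemma trace_weylLin (hψ : ψ ≠ 1) {w : Fin n → K} (hw : w ≠ 0) :
    LinearMap.trace ℂ _ (weylLin b ψ w) = 0 := by
  classical
  rw [LinearMap.trace_eq_matrix_trace ℂ (EuclideanSpace.basisFun (Fin n → F) ℂ).toBasis,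
    Matrix.trace]
  have key : ∀ x : Fin n → F, LinearMap.toMatrix (EuclideanSpace.basisFun (Fin n → F) ℂ).toBasis
      (EuclideanSpace.basisFun (Fin n → F) ℂ).toBasis (weylLin b ψ w) x x =
      ψ (∑ i, x i * b.repr (w i) 1) * if (fun i => b.repr (w i) 0) = 0 then 1 else 0 := by
    intro x
    simp [LinearMap.toMatrix_apply, weylLin_apply, mul_comm]
  simp only [Matrix.diag_apply, key]
  split_ifs with h0
  · simp only [mul_one]
    rw [sum_addChar_dot hψ (fun i => b.repr (w i) 1), if_neg]
    intro h1
    refine hw (funext fun i => b.repr.injective (Finsupp.ext fun j => ?_))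
    fin_cases j
    · simpa using congrFun h0 i
    · simpa using congrFun h1 i
  · simp

lemma trace_weylLin_zero :
    LinearMap.trace ℂ _ (weylLin b ψ (0 : Fin n → K)) = (Fintype.card F : ℂ) ^ n := by
  rw [weylLin_zero, LinearMap.trace_id, finrank_euclideanSpace]
  simp

/-- An operator acting on `S` is a linear combination of Weyl operators supported on `S`. -/
lemma mulVec_mem_span_weylLin (hψ : ψ ≠ 1) {E : QuditOp F n} {S : Finset (Fin n)}
    (hE : E.ActsOn S) :
    ∃ c : (S → F) → (S → F) → ℂ, ∃ w : (S → F) → (S → F) → Fin n → K,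
      (∀ s t, ∀ i ∉ S, w s t i = 0) ∧ ∀ φ : QuditSpace F n,
        (WithLp.toLp 2 (E.mulVec φ.ofLp) : QuditSpace F n) =
          ∑ s, ∑ t, c s t • weylLin b ψ (w s t) φ := by
  classical
  obtain ⟨M, hM, hM0⟩ := hE
  let ext : (S → F) → Fin n → F := fun s i => if hi : i ∈ S then s ⟨i, hi⟩ else 0
  have ext_coe : ∀ s (i : S), ext s i = s i := fun s i => by simp [ext]
  have ext_off : ∀ s, ∀ i ∉ S, ext s i = 0 := fun s i hi => by simp [ext, hi]
  have sum_ext : ∀ t (x : Fin n → F), ∑ i, ext t i * x i = ∑ i : S, t i * x i := by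
    intro t x
    rw [← Finset.sum_subset (Finset.subset_univ S) (fun i _ hi => by rw [ext_off t i hi, zero_mul]),
      ← Finset.sum_coe_sort S]
    exact sum_congr rfl fun i _ => by rw [ext_coe]
  -- For each shift `s`, these are the Fourier coefficients of `y ↦ M y (y - s)`, the `s`-th
  -- generalized diagonal of `M`.
  let c : (S → F) → (S → F) → ℂ := fun s t =>
    ((Fintype.card F : ℂ) ^ Fintype.card S)⁻¹ * ∑ z : S → F, M z (z - s) * ψ (-∑ i, t i * z i)
  let w : (S → F) → (S → F) → Fin n → K := fun s t i => ext s i • b 0 + ext t i • b 1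
  have hw0 : ∀ s t, (fun i => b.repr (w s t i) 0) = ext s := fun s t => by
    funext i
    simp [w]
  have hw1 : ∀ s t i, b.repr (w s t i) 1 = ext t i := fun s t i => by
    simp [w]
  have hc : ∀ s (y : S → F), M y (y - s) = ∑ t, c s t * ψ (∑ i, t i * y i) := by
    intro s y
    have hq : ((Fintype.card F : ℂ) ^ Fintype.card S) ≠ 0 :=
      pow_ne_zero _ (Nat.cast_ne_zero.2 Fintype.card_ne_zero)
    have h1 : ∀ t, c s t * ψ (∑ i, t i * y i) = ((Fintype.card F : ℂ) ^ Fintype.card S)⁻¹ *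
        ∑ z : S → F, M z (z - s) * ψ (∑ i, t i * (y - z) i) := by
      intro t
      simp only [c]
      rw [mul_assoc, sum_mul]
      congr 1
      refine sum_congr rfl fun z _ => ?_
      rw [mul_assoc, ← AddChar.map_add_eq_mul]
      congr 2
      rw [← sum_neg_distrib, ← sum_add_distrib]
      exact sum_congr rfl fun i _ => by simp only [Pi.sub_apply]; ring
    simp only [h1]
    rw [← mul_sum, sum_comm]
    simp only [← mul_sum, sum_addChar_dot hψ]
    rw [Finset.sum_eq_single y]
    · simp only [sub_self, if_true]
      field_simp
    · intro z _ hz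
      rw [if_neg (by rwa [sub_eq_zero, eq_comm]), mul_zero]
    · simp
  refine ⟨c, w, fun s t i hi => by simp [w, ext_off _ i hi], fun φ => PiLp.ext fun x => ?_⟩
  have h2 : (E.mulVec φ.ofLp) x =
      ∑ s : S → F, M (fun i : S => x i) ((fun i : S => x i) - s) * φ (x - ext s) := by
    rw [Matrix.mulVec, dotProduct]
    symm
    refine Fintype.sum_of_injective (fun s : S → F => x - ext s) ?_ _ _ ?_ ?_
    · intro s s' h
      funext i
      have := congrFun (sub_right_injective h) i
      rwa [ext_coe, ext_coe] at this
    · intro y hy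
      rw [hM0 x y, zero_mul]
      intro h
      refine hy ⟨fun i => x i - y i, funext fun i => ?_⟩
      by_cases hi : i ∈ S
      · simp [ext, hi]
      · simp [ext, hi, h i hi]
    · intro s
      rw [hM x (x - ext s) (fun i hi => by simp [ext_off s i hi])]
      congr 2
      funext i
      simp [ext_coe]
  change (E.mulVec φ.ofLp) x = _
  rw [h2]
  simp only [WithLp.ofLp_sum, Finset.sum_apply, PiLp.smul_apply, weylLin_apply, hw0, hw1, sum_ext,
    smul_eq_mul]
  refine sum_congr rfl fun s _ => ?_
  rw [hc s, sum_mul]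
  exact sum_congr rfl fun t _ => by ring

end Weyl

/-! ### Hermitian duality and the symplectic form -/

section HermitianSymplectic

open Finset

lemma exists_pow_card_ne {F K : Type*} [Fintype F] [Field F] [Fintype K] [Field K]
    (hK : Fintype.card K = Fintype.card F ^ 2) :
    ∃ x : K, x ^ Fintype.card F ≠ x := by
  by_contra! h
  have hF : 1 < Fintype.card F := Fintype.one_lt_card
  have h1 : (Polynomial.X ^ Fintype.card F - Polynomial.X : Polynomial K) ≠ 0 :=
    FiniteField.X_pow_card_sub_X_ne_zero K hF
  have h2 := Polynomial.card_roots' (Polynomial.X ^ Fintype.card F - Polynomial.X : Polynomial K)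
  rw [FiniteField.X_pow_card_sub_X_natDegree_eq K hF] at h2
  have h3 : (univ : Finset K).val ≤
      (Polynomial.X ^ Fintype.card F - Polynomial.X : Polynomial K).roots := by
    rw [Multiset.le_iff_subset univ.nodup]
    intro x _
    rw [Polynomial.mem_roots h1]
    simp [h x]
  have h4 := (Multiset.card_le_card h3).trans h2
  rw [Finset.card_val, card_univ, hK] at h4
  nlinarith

variable {F K : Type*} [Field F] [Fintype F] [Field K] [Algebra F K] {n : ℕ}

lemma hermInner_smul_right (q : ℕ) (a : K) (w w' : Fin n → K) :
    hermInner q w (a • w') = a ^ q * hermInner q w w' := by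
  simp only [hermInner, mul_sum, Pi.smul_apply, smul_eq_mul, mul_pow]
  exact sum_congr rfl fun i _ => by ring

lemma hermInner_smul_left (q : ℕ) (a : K) (w w' : Fin n → K) :
    hermInner q (a • w) w' = a * hermInner q w w' := by
  simp only [hermInner, mul_sum, Pi.smul_apply, smul_eq_mul, mul_assoc]

/-- The antisymmetrized Hermitian form is `F`-bilinear and alternating, so in two coordinates it is
a determinant times its value on the basis. -/
lemma symplForm_mul_eq (b : Module.Basis (Fin 2) F K) (w w' : Fin n → K) :
    algebraMap F K (symplForm b w w') *
      (b 0 * b 1 ^ Fintype.card F - b 1 * b 0 ^ Fintype.card F) =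
    hermInner (Fintype.card F) w w' - hermInner (Fintype.card F) w' w := by
  have hx : ∀ x : K, x = algebraMap F K (b.repr x 0) * b 0 + algebraMap F K (b.repr x 1) * b 1 := by
    intro x
    conv_lhs => rw [← b.sum_repr x]
    simp [Fin.sum_univ_two, Algebra.smul_def]
  have hxq : ∀ x : K, x ^ Fintype.card F = algebraMap F K (b.repr x 0) * b 0 ^ Fintype.card F +
      algebraMap F K (b.repr x 1) * b 1 ^ Fintype.card F := by
    intro x
    conv_lhs => rw [hx x]
    simp only [← FiniteField.frobeniusAlgHom_apply F K, map_add, map_mul, AlgHom.commutes]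
  simp only [symplForm, hermInner, map_sum, sum_mul, ← sum_sub_distrib, map_sub, map_mul]
  refine sum_congr rfl fun i _ => ?_
  rw [hxq (w i), hxq (w' i)]
  conv_rhs => rw [hx (w i), hx (w' i)]
  simp only [map_add, Finsupp.add_apply, ← Algebra.smul_def, map_smul, Finsupp.smul_apply,
    Module.Basis.repr_self, smul_eq_mul]
  simp [Algebra.smul_def]
  ring

variable [Fintype K]

lemma symplForm_eq_zero_iff (hK : Fintype.card K = Fintype.card F ^ 2)
    (b : Module.Basis (Fin 2) F K) (w w' : Fin n → K) :
    symplForm b w w' = 0 ↔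
      hermInner (Fintype.card F) w w' = hermInner (Fintype.card F) w' w := by
  -- If this factor vanished, words of length one, `x` against `1`, would give `x = x^q` for every
  -- `x`.
  have hδ : b 0 * b 1 ^ Fintype.card F - b 1 * b 0 ^ Fintype.card F ≠ 0 := by
    intro h0
    obtain ⟨x, hx⟩ := exists_pow_card_ne (F := F) hK
    have := symplForm_mul_eq b (fun _ : Fin 1 => x) (fun _ => 1)
    rw [h0, mul_zero] at this
    simp only [hermInner, Finset.sum_const, card_univ, Fintype.card_fin, one_smul, one_pow, mul_one,
      one_mul] at this
    exact hx (sub_eq_zero.1 this.symm).symm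
  rw [← sub_eq_zero (a := hermInner _ _ _), ← symplForm_mul_eq b]
  simp [hδ]

lemma hermInner_swap (hK : Fintype.card K = Fintype.card F ^ 2) (w w' : Fin n → K) :
    hermInner (Fintype.card F) w' w = hermInner (Fintype.card F) w w' ^ Fintype.card F := by
  simp only [hermInner, ← FiniteField.frobeniusAlgHom_apply F K, map_sum, map_mul]
  refine sum_congr rfl fun i _ => ?_
  simp only [FiniteField.frobeniusAlgHom_apply, ← pow_mul]
  rw [← sq, ← hK, FiniteField.pow_card, mul_comm]

lemma symplForm_eq_zero_of_mem_hermDual (hK : Fintype.card K = Fintype.card F ^ 2)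
    (b : Module.Basis (Fin 2) F K) {C : Submodule K (Fin n → K)} {w c : Fin n → K}
    (hw : w ∈ hermDual (Fintype.card F) C) (hc : c ∈ C) : symplForm b w c = 0 := by
  rw [symplForm_eq_zero_iff hK, hermInner_swap hK w c, hw c hc, zero_pow Fintype.card_ne_zero]

/-- `F`-multiples of `c` turn the character condition into vanishing of the symplectic form.
Comparing `c` with `x • c` for some `x^q ≠ x` then forces the Hermitian product itself to vanish:
here `K`-linearity of `C` is essential. -/
lemma mem_hermDual_of_addChar_symplForm (hK : Fintype.card K = Fintype.card F ^ 2)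
    (b : Module.Basis (Fin 2) F K) {ψ : AddChar F ℂ} (hψ : ψ ≠ 1)
    {C : Submodule K (Fin n → K)} {w : Fin n → K}
    (hw : ∀ c ∈ C, ψ (-symplForm b w c) = 1) : w ∈ hermDual (Fintype.card F) C := by
  have h0 : ∀ c ∈ C, symplForm b w c = 0 := by
    intro c hc
    by_contra hne
    refine hψ (DFunLike.ext _ _ fun a => ?_)
    have h1 := hw ((-(a / symplForm b w c)) • c) (by
      rw [← algebraMap_smul K]
      exact C.smul_mem _ hc)
    rwa [symplForm_smul_right, neg_mul, neg_neg, div_mul_cancel₀ _ hne] at h1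
  intro c hc
  obtain ⟨x, hx⟩ := exists_pow_card_ne (F := F) hK
  have h1 := (symplForm_eq_zero_iff hK b w c).1 (h0 c hc)
  have h2 := (symplForm_eq_zero_iff hK b w (x • c)).1 (h0 _ (C.smul_mem x hc))
  rw [hermInner_smul_right, hermInner_smul_left, ← h1, ← sub_eq_zero, ← sub_mul] at h2
  exact (mul_eq_zero.1 h2).resolve_left (sub_ne_zero.2 hx)

end HermitianSymplectic

/-! ### The stabilizer code of a self-orthogonal code -/

section Stabilizer

open Finset

variable {F K : Type*} [Field F] [Fintype F] [Field K] [Algebra F K] {n : ℕ}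
  (b : Module.Basis (Fin 2) F K) (ψ : AddChar F ℂ)

/-- The Weyl operator of `w`, normalized such that the operators that belong to a code that is
isotropic for the symplectic form multiply like its codewords. -/
noncomputable def weylNorm (w : Fin n → K) : Module.End ℂ (QuditSpace F n) :=
  ψ (-(2⁻¹ * ∑ i, b.repr (w i) 1 * b.repr (w i) 0)) • weylLin b ψ w

lemma weylNorm_zero : weylNorm b ψ (0 : Fin n → K) = 1 := by
  rw [weylNorm, weylLin_zero]
  simp
  rfl

/-- Polarizing the half quadratic form in the phase symmetrizes the cocycle of `weylLin_mul`; the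
discrepancy is half the symplectic form. -/
lemma weylNorm_mul (h2 : (2 : F) ≠ 0) {w w' : Fin n → K} (h : symplForm b w w' = 0) :
    weylNorm b ψ w * weylNorm b ψ w' = weylNorm b ψ (w + w') := by
  simp only [weylNorm, smul_mul_smul_comm, weylLin_mul, smul_smul, ← AddChar.map_add_eq_mul]
  congr 2
  rw [symplForm, sum_sub_distrib] at h
  have e1 : ∑ i, b.repr ((w + w') i) 1 * b.repr ((w + w') i) 0 =
      ∑ i, b.repr (w i) 1 * b.repr (w i) 0 + ∑ i, b.repr (w i) 1 * b.repr (w' i) 0 +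
      ∑ i, b.repr (w' i) 1 * b.repr (w i) 0 + ∑ i, b.repr (w' i) 1 * b.repr (w' i) 0 := by
    simp only [← sum_add_distrib, Pi.add_apply, map_add, Finsupp.add_apply]
    exact sum_congr rfl fun i _ => by ring
  have e2 : ∑ i, b.repr (w i) 0 * b.repr (w' i) 1 = ∑ i, b.repr (w' i) 1 * b.repr (w i) 0 :=
    sum_congr rfl fun i _ => mul_comm _ _
  rw [e2] at h
  rw [e1]
  field_simp
  linear_combination -h

/-- The representation of an isotropic code by normalized Weyl operators. -/
noncomputable def weylRep (h2 : (2 : F) ≠ 0) (C : Submodule K (Fin n → K))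
    (hC : ∀ w ∈ C, ∀ w' ∈ C, symplForm b w w' = 0) :
    Representation ℂ (Multiplicative C) (QuditSpace F n) where
  toFun w := weylNorm b ψ (w.toAdd : Fin n → K)
  map_one' := weylNorm_zero b ψ
  map_mul' w w' := (weylNorm_mul b ψ h2 (hC _ w.toAdd.2 _ w'.toAdd.2)).symm

variable {ψ} {C : Submodule K (Fin n → K)} (h2 : (2 : F) ≠ 0)
  (hC : ∀ w ∈ C, ∀ w' ∈ C, symplForm b w w' = 0)

/-- The stabilizer code of `C`. -/
noncomputable def stabilizerCode (ψ : AddChar F ℂ) : Submodule ℂ (QuditSpace F n) :=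
  (weylRep b ψ h2 C hC).invariants

lemma mem_stabilizerCode (φ : QuditSpace F n) :
    φ ∈ stabilizerCode b h2 hC ψ ↔ ∀ w ∈ C, weylLin b ψ w φ =
      ψ (2⁻¹ * ∑ i, b.repr (w i) 1 * b.repr (w i) 0) • φ := by
  rw [stabilizerCode, Representation.mem_invariants]
  have key : ∀ w : Fin n → K, weylNorm b ψ w φ = φ ↔ weylLin b ψ w φ =
      ψ (2⁻¹ * ∑ i, b.repr (w i) 1 * b.repr (w i) 0) • φ := by
    intro w
    rw [weylNorm, LinearMap.smul_apply]
    have h1 := AddChar.map_add_eq_mul ψ (-(2⁻¹ * ∑ i, b.repr (w i) 1 * b.repr (w i) 0))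
      (2⁻¹ * ∑ i, b.repr (w i) 1 * b.repr (w i) 0)
    rw [neg_add_cancel, AddChar.map_zero_eq_one] at h1
    constructor
    · intro h
      conv_rhs => rw [← h, smul_smul, mul_comm, ← h1, one_smul]
    · intro h
      rw [h, smul_smul, ← h1, one_smul]
  exact ⟨fun h w hw => (key w).1 (h (Multiplicative.ofAdd ⟨w, hw⟩)),
    fun h w => (key _).2 (h _ w.toAdd.2)⟩

lemma trace_mul_averageMap [Fintype (Multiplicative C)]
    [Invertible (Fintype.card (Multiplicative C) : ℂ)]
    (T : Module.End ℂ (QuditSpace F n)) :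
    LinearMap.trace ℂ _ (T * (weylRep b ψ h2 C hC).averageMap) =
      (Fintype.card (Multiplicative C) : ℂ)⁻¹ *
        ∑ w : Multiplicative C, LinearMap.trace ℂ _ (T * weylNorm b ψ (w.toAdd : Fin n → K)) := by
  rw [Representation.averageMap, GroupAlgebra.average, map_smul, map_sum, mul_smul_comm, mul_sum,
    map_smul, map_sum, invOf_eq_inv, smul_eq_mul]
  simp only [Representation.asAlgebraHom_of]
  rfl

/-- The dimension of the invariants is the trace of the averaging projection, to which only the zero
codeword contributes. -/
lemma finrank_stabilizerCode [Finite C] (hψ : ψ ≠ 1) :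
    (Module.finrank ℂ (stabilizerCode b h2 hC ψ) : ℂ) * Nat.card C = (Fintype.card F : ℂ) ^ n := by
  have : Fintype (Multiplicative C) := Fintype.ofFinite _
  have hne : (Fintype.card (Multiplicative C) : ℂ) ≠ 0 := Nat.cast_ne_zero.2 Fintype.card_ne_zero
  have : Invertible (Fintype.card (Multiplicative C) : ℂ) := invertibleOfNonzero hne
  have hcard : (Nat.card C : ℂ) = Fintype.card (Multiplicative C) := by
    rw [← Nat.card_eq_fintype_card]
    rfl
  have h := (weylRep b ψ h2 C hC).isProj_averageMap.trace
  rw [stabilizerCode, ← h, ← one_mul (weylRep b ψ h2 C hC).averageMap, trace_mul_averageMap,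
    Finset.sum_eq_single 1]
  · simp only [toAdd_one, ZeroMemClass.coe_zero, one_mul, weylNorm, map_smul, trace_weylLin_zero]
    rw [hcard]
    field_simp
    simp
  · intro w _ hw
    rw [one_mul, weylNorm, map_smul, trace_weylLin b hψ, smul_zero]
    intro h0
    exact hw (Multiplicative.toAdd.injective (Subtype.ext h0))
  · simp

lemma isHermitianConstruction_stabilizerCode [Finite C] (hψ : ψ ≠ 1) :
    IsHermitianConstruction C (stabilizerCode b h2 hC ψ) := by
  refine ⟨fun h => ?_, b, ψ, fun w => ψ (2⁻¹ * ∑ i, b.repr (w i) 1 * b.repr (w i) 0), hψ,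
    mem_stabilizerCode b h2 hC⟩
  have h1 := finrank_stabilizerCode b h2 hC hψ
  rw [h, finrank_bot, Nat.cast_zero, zero_mul] at h1
  exact pow_ne_zero n (Nat.cast_ne_zero.2 Fintype.card_ne_zero) h1.symm

/-- A Weyl operator that does not commute with the stabilizer maps the code to its orthogonal
complement. -/
lemma inner_weylLin_eq_zero {w c : Fin n → K} (hc : c ∈ C) (hwc : ψ (-symplForm b w c) ≠ 1)
    {u v : QuditSpace F n} (hu : u ∈ stabilizerCode b h2 hC ψ)
    (hv : v ∈ stabilizerCode b h2 hC ψ) : inner ℂ u (weylLin b ψ w v) = 0 := by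
  rw [mem_stabilizerCode] at hu hv
  have h1 := LinearMap.congr_fun (weylLin_mul_comm b ψ w c) v
  simp only [Module.End.mul_apply, LinearMap.smul_apply] at h1
  rw [hv c hc, map_smul] at h1
  have h3 := inner_weylLin_weylLin b ψ c u (weylLin b ψ w v)
  set z := ψ (2⁻¹ * ∑ i, b.repr (c i) 1 * b.repr (c i) 0) with hz
  have hzz : z * star z = 1 := by
    have := AddChar.map_add_eq_mul ψ (2⁻¹ * ∑ i, b.repr (c i) 1 * b.repr (c i) 0)
      (-(2⁻¹ * ∑ i, b.repr (c i) 1 * b.repr (c i) 0))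
    rw [add_neg_cancel, AddChar.map_zero_eq_one, AddChar.map_neg_eq_conj] at this
    exact this.symm
  have h4 : inner ℂ u (z • weylLin b ψ w v) =
      ψ (-symplForm b w c) * inner ℂ u (weylLin b ψ c (weylLin b ψ w v)) := by
    rw [h1, inner_smul_right]
  rw [hu c hc, inner_smul_left] at h3
  rw [inner_smul_right] at h4
  change star z * _ = _ at h3
  have h5 : inner ℂ u (weylLin b ψ w v) * (ψ (-symplForm b w c) - 1) = 0 := by
    linear_combination -ψ (-symplForm b w c) * h3 - star z * h4 +
      inner ℂ u (weylLin b ψ w v) * hzz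
  exact (mul_eq_zero.1 h5).resolve_right (sub_ne_zero.2 hwc)

/-- Errors on fewer qudits than the dual distance are detected. -/
lemma detects_stabilizerCode [Fintype K] (hK : Fintype.card K = Fintype.card F ^ 2) (hψ : ψ ≠ 1)
    {E : QuditOp F n} {S : Finset (Fin n)} (hE : E.ActsOn S)
    (hS : ∀ w ∈ hermDual (Fintype.card F) C, (∀ i ∉ S, w i = 0) → w = 0) :
    Detects (stabilizerCode b h2 hC ψ) E := by
  classical
  obtain ⟨c, w, hw, hcw⟩ := mulVec_mem_span_weylLin b hψ hE
  -- Only the identity component of the error survives between code states.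
  refine ⟨∑ s, ∑ t, if w s t = 0 then c s t else 0, fun u hu v hv => ?_⟩
  rw [hcw, inner_sum, sum_mul]
  refine sum_congr rfl fun s _ => ?_
  rw [inner_sum, sum_mul]
  refine sum_congr rfl fun t _ => ?_
  rw [inner_smul_right]
  split_ifs with h0
  · rw [h0, weylLin_zero]
    rfl
  · have : ∃ x ∈ C, ψ (-symplForm b (w s t) x) ≠ 1 := by
      by_contra! h
      exact h0 (hS _ (mem_hermDual_of_addChar_symplForm hK b hψ h) (hw s t))
    obtain ⟨x, hx, hne⟩ := this
    rw [inner_weylLin_eq_zero b h2 hC hx hne hu hv, mul_zero, zero_mul]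

/-- The Weyl operator of a word of the dual that is not a codeword is not detected. -/
lemma not_scalar_weylLin [Finite C] (hψ : ψ ≠ 1) {w : Fin n → K} (hw : ∀ c ∈ C, symplForm b w c = 0)
    (hwC : w ∉ C) :
    ¬ ∃ z : ℂ, ∀ u ∈ stabilizerCode b h2 hC ψ, ∀ v ∈ stabilizerCode b h2 hC ψ,
      inner ℂ u (weylLin b ψ w v) = z * inner ℂ u v := by
  rintro ⟨z, hz⟩
  have hfin := finrank_stabilizerCode b h2 hC hψ
  have hq : (Fintype.card F : ℂ) ^ n ≠ 0 := pow_ne_zero n (Nat.cast_ne_zero.2 Fintype.card_ne_zero)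
  have hmem : ∀ v ∈ stabilizerCode b h2 hC ψ, weylLin b ψ w v ∈ stabilizerCode b h2 hC ψ := by
    intro v hv
    rw [mem_stabilizerCode] at hv ⊢
    intro c hc
    have h1 := LinearMap.congr_fun (weylLin_mul_comm b ψ w c) v
    rw [hw c hc, neg_zero, AddChar.map_zero_eq_one, one_smul] at h1
    simp only [Module.End.mul_apply] at h1
    rw [← h1, hv c hc, map_smul]
  -- The operator preserves the code, so the difference can be paired with itself.
  have hscal : ∀ v ∈ stabilizerCode b h2 hC ψ, weylLin b ψ w v = z • v := by
    intro v hv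
    have hd : weylLin b ψ w v - z • v ∈ stabilizerCode b h2 hC ψ :=
      sub_mem (hmem v hv) (Submodule.smul_mem _ z hv)
    have h1 := hz _ hd v hv
    rw [← sub_eq_zero, ← inner_smul_right, ← inner_sub_right, inner_self_eq_zero, sub_eq_zero] at h1
    exact h1
  have : Fintype (Multiplicative C) := Fintype.ofFinite _
  have hne : (Fintype.card (Multiplicative C) : ℂ) ≠ 0 := Nat.cast_ne_zero.2 Fintype.card_ne_zero
  have : Invertible (Fintype.card (Multiplicative C) : ℂ) := invertibleOfNonzero hne
  have hproj := (weylRep b ψ h2 C hC).isProj_averageMap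
  have h3 : weylLin b ψ w * (weylRep b ψ h2 C hC).averageMap =
      z • (weylRep b ψ h2 C hC).averageMap :=
    LinearMap.ext fun v => hscal _ (hproj.map_mem v)
  -- No `w + c` with `c ∈ C` is zero, so every trace vanishes. Hence `z = 0`, against injectivity on
  -- a nonzero code.
  have h4 : LinearMap.trace ℂ _ (weylLin b ψ w * (weylRep b ψ h2 C hC).averageMap) = 0 := by
    rw [trace_mul_averageMap, Finset.sum_eq_zero, mul_zero]
    intro c _
    rw [weylNorm, mul_smul_comm, weylLin_mul, map_smul, map_smul, trace_weylLin b hψ, smul_zero,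
      smul_zero]
    intro h0
    exact hwC (by rw [eq_neg_of_add_eq_zero_left h0]; exact C.neg_mem c.toAdd.2)
  rw [h3, map_smul, hproj.trace, smul_eq_mul] at h4
  have hr : (Module.finrank ℂ (stabilizerCode b h2 hC ψ) : ℂ) ≠ 0 := by
    intro h0
    rw [h0, zero_mul] at hfin
    exact hq hfin.symm
  have hz0 : z = 0 := (mul_eq_zero.1 h4).resolve_right hr
  have hbot : stabilizerCode b h2 hC ψ = ⊥ := by
    rw [Submodule.eq_bot_iff]
    intro v hv
    have := hscal v hv
    rw [hz0, zero_smul] at this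
    exact (injective_iff_map_eq_zero _).1 (weylLin_injective b ψ w) v this
  rw [hbot, finrank_bot, Nat.cast_zero] at hr
  exact hr rfl

lemma exists_actsOn_weylLin (w : Fin n → K) (S : Finset (Fin n)) (hw : ∀ i ∉ S, w i = 0) :
    ∃ E : QuditOp F n, E.ActsOn S ∧ ∀ φ : QuditSpace F n,
      (WithLp.toLp 2 (E.mulVec φ.ofLp) : QuditSpace F n) = weylLin b ψ w φ := by
  classical
  let M : Matrix (S → F) (S → F) ℂ := fun x y =>
    if y = x - (fun i : S => b.repr (w i) 0) then ψ (∑ i : S, b.repr (w i) 1 * x i) else 0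
  let E : QuditOp F n := fun x y =>
    if y = x - (fun i => b.repr (w i) 0) then ψ (∑ i, b.repr (w i) 1 * x i) else 0
  refine ⟨E, ⟨M, ?_, ?_⟩, ?_⟩
  · intro x y hxy
    have h1 : ∑ i, b.repr (w i) 1 * x i = ∑ i : S, b.repr (w i) 1 * x i := by
      rw [← Finset.sum_subset (Finset.subset_univ S) (fun i _ hi => by simp [hw i hi]),
        ← Finset.sum_coe_sort S]
    have h3 : y = x - (fun i => b.repr (w i) 0) ↔
        (fun i : S => y i) = (fun i : S => x i) - (fun i : S => b.repr (w i) 0) := by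
      constructor
      · intro h
        rw [h]
        rfl
      · intro h
        funext i
        by_cases hi : i ∈ S
        · exact congrFun h ⟨i, hi⟩
        · simp [hw i hi, hxy i hi]
    simp only [E, M, h1, h3]
  · intro x y hxy
    refine if_neg fun h => hxy fun i hi => ?_
    rw [h]
    simp [hw i hi]
  · intro φ
    refine PiLp.ext fun x => ?_
    change ∑ y, E x y * φ y = _
    simp only [E, ite_mul, zero_mul, Finset.sum_ite_eq', Finset.mem_univ, if_true]
    rfl

/-- The Hermitian construction for a self-orthogonal code whose Hermitian dual has minimum
distance `k + 1`, attained by a word outside the code. -/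
theorem exists_quantumMDS_of_hermSelfOrthogonal [Fintype K]
    (hK : Fintype.card K = Fintype.card F ^ 2) (hodd : Odd (Fintype.card F)) (k : ℕ)
    (hself : IsHermSelfOrthogonal (Fintype.card F) C) (hdim : Module.finrank K C = k)
    (hkn : 2 * k ≤ n)
    (hdual : ∀ S : Finset (Fin n), S.card ≤ k → ∀ w ∈ hermDual (Fintype.card F) C,
      (∀ i ∉ S, w i = 0) → w = 0)
    (hword : ∃ S : Finset (Fin n), S.card = k + 1 ∧ ∃ w ∈ hermDual (Fintype.card F) C,
      (∀ i ∉ S, w i = 0) ∧ w ∉ C) :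
    ∃ Q : Submodule ℂ (QuditSpace F n), IsHermitianConstruction C Q ∧
      IsQuantumMDSCode Q (n - 2 * k) (k + 1) := by
  have hF1 : 1 < Fintype.card F := Fintype.one_lt_card
  have hrank : Module.finrank F K = 2 := by
    have := Module.card_eq_pow_finrank (K := F) (V := K)
    rw [hK] at this
    exact (Nat.pow_right_injective hF1 this).symm
  let b : Module.Basis (Fin 2) F K := Module.finBasisOfFinrankEq F K hrank
  obtain ⟨ψ, hψ⟩ : ∃ ψ : AddChar F ℂ, ψ ≠ 1 := by
    obtain ⟨ψ, hψ⟩ := AddChar.exists_apply_ne_zero.2 (one_ne_zero (α := F))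
    exact ⟨ψ, fun h => hψ (by rw [h]; rfl)⟩
  have h2 : (2 : F) ≠ 0 := by
    intro h
    have h3 : ((Fintype.card F : ℕ) : F) = 0 := Nat.cast_card_eq_zero F
    obtain ⟨j, hj⟩ := hodd
    rw [hj] at h3
    push_cast at h3
    rw [h, zero_mul, zero_add] at h3
    exact one_ne_zero h3
  have hC : ∀ w ∈ C, ∀ w' ∈ C, symplForm b w w' = 0 := fun w hw w' hw' =>
    symplForm_eq_zero_of_mem_hermDual hK b (hself hw) hw'
  refine ⟨stabilizerCode b h2 hC ψ, isHermitianConstruction_stabilizerCode b h2 hC hψ,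
    ⟨⟨?_, ?_, ?_⟩, by omega⟩⟩
  · have h3 := finrank_stabilizerCode b h2 hC hψ
    have h4 : Nat.card C = Fintype.card F ^ (2 * k) := by
      have := Fintype.ofFinite C
      rw [Nat.card_eq_fintype_card, Module.card_eq_pow_finrank (K := K), hdim, hK, pow_mul]
    rw [h4] at h3
    have h5 : Module.finrank ℂ (stabilizerCode b h2 hC ψ) * Fintype.card F ^ (2 * k) =
        Fintype.card F ^ n := by exact_mod_cast h3
    refine Nat.eq_of_mul_eq_mul_right (pow_pos (zero_lt_one.trans hF1) (2 * k)) ?_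
    rw [h5, ← pow_add, Nat.sub_add_cancel hkn]
  · obtain ⟨S, hS, w, hw, hsupp, hwC⟩ := hword
    obtain ⟨E, hE, hEw⟩ := exists_actsOn_weylLin b (ψ := ψ) w S hsupp
    refine ⟨S, E, hS, hE, fun ⟨z, hz⟩ => ?_⟩
    refine not_scalar_weylLin b h2 hC hψ
      (fun c hc => symplForm_eq_zero_of_mem_hermDual hK b hw hc) hwC ⟨z, fun u hu v hv => ?_⟩
    rw [← hEw]
    exact hz u hu v hv
  · rintro d ⟨S, E, rfl, hE, hnd⟩
    by_contra! hlt
    exact hnd (detects_stabilizerCode b h2 hC hK hψ hE (hdual S (by omega)))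

end Stabilizer

/-! ### Generalized Reed–Solomon codes -/

section GRS

open Finset Polynomial

variable {K : Type*} [Field K] {n k : ℕ} {a v : Fin n → K}

lemma mem_grsCode {x : Fin n → K} :
    x ∈ grsCode k a v ↔ ∃ f : K[X], f.degree < k ∧ ∀ i, x i = v i * f.eval (a i) := by
  simp only [grsCode, Submodule.mem_map, mem_degreeLT]
  refine exists_congr fun f => and_congr_right fun _ => ?_
  rw [eq_comm, funext_iff]
  rfl

/-- A codeword that vanishes at `k` coordinates is zero. -/
lemma eq_zero_of_mem_grsCode (ha : Function.Injective a) {x : Fin n → K} (hx : x ∈ grsCode k a v)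
    (hv : ∀ i, v i ≠ 0) {S : Finset (Fin n)} (hS : k ≤ S.card) (h0 : ∀ i ∈ S, x i = 0) :
    x = 0 := by
  obtain ⟨f, hf, hxf⟩ := mem_grsCode.1 hx
  have hf0 : f = 0 := by
    refine eq_zero_of_degree_lt_of_eval_index_eq_zero _ ha.injOn
      (hf.trans_le (by exact_mod_cast hS)) fun i hi => ?_
    have := h0 i hi
    rw [hxf] at this
    exact (mul_eq_zero.1 this).resolve_left (hv i)
  funext i
  simp [hxf, hf0]

lemma finrank_grsCode (ha : Function.Injective a) (hv : ∀ i, v i ≠ 0) (hk : k ≤ n) :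
    Module.finrank K (grsCode k a v) = k := by
  have h1 : Module.finrank K (degreeLT K k) = k := by
    rw [(degreeLTEquiv K k).finrank_eq]
    simp
  rw [grsCode, ← LinearMap.range_domRestrict, LinearMap.finrank_range_of_inj, h1]
  rw [injective_iff_map_eq_zero]
  intro f hf
  refine Subtype.ext ?_
  refine eq_zero_of_degree_lt_of_eval_index_eq_zero univ ha.injOn
    ((mem_degreeLT.1 f.2).trans_le (by simpa using hk)) fun i _ => ?_
  have h2 : v i * (f : K[X]).eval (a i) = 0 := congrFun hf i
  exact (mul_eq_zero.1 h2).resolve_left (hv i)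

/-- The Hermitian dual of `GRS_k` has minimum distance greater than `k`. -/
lemma eq_zero_of_mem_hermDual_grsCode (ha : Function.Injective a) (hv : ∀ i, v i ≠ 0) {q : ℕ}
    (hq : q ≠ 0) {S : Finset (Fin n)} (hS : S.card ≤ k) {w : Fin n → K}
    (hw : w ∈ hermDual q (grsCode k a v)) (h0 : ∀ i ∉ S, w i = 0) : w = 0 := by
  classical
  funext i
  by_contra hi
  have hiS : i ∈ S := by
    by_contra h
    exact hi (h0 i h)
  -- This codeword isolates the coordinate `i` within the support `S`.
  have hmem : (fun j => v j * (Lagrange.basis S a i).eval (a j)) ∈ grsCode k a v := by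
    refine mem_grsCode.2 ⟨_, ?_, fun _ => rfl⟩
    rw [Lagrange.degree_basis ha.injOn hiS]
    have := card_pos.2 ⟨i, hiS⟩
    exact_mod_cast (by omega : S.card - 1 < k)
  have h1 := hw _ hmem
  rw [hermInner, Finset.sum_eq_single i] at h1
  · rw [Lagrange.eval_basis_self ha.injOn hiS, mul_one] at h1
    exact (mul_ne_zero hi (pow_ne_zero q (hv i))) h1
  · intro j _ hj
    by_cases hjS : j ∈ S
    · rw [Lagrange.eval_basis_of_ne hj.symm hjS, mul_zero, zero_pow hq, mul_zero]
    · rw [h0 j hjS, zero_mul]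
  · simp

/-- The reciprocals of the products of node differences annihilate all polynomials of degree less
than the number of nodes minus one. -/
lemma sum_eval_div_prod_eq_zero {ι : Type*} [DecidableEq ι] {s : Finset ι} {y : ι → K}
    (hy : Set.InjOn y s) {P : K[X]} (hP : P.degree < (s.card - 1 : ℕ)) :
    ∑ i ∈ s, P.eval (y i) / ∏ j ∈ s.erase i, (y i - y j) = 0 := by
  rw [← Lagrange.coeff_eq_sum hy (hP.trans_le (by exact_mod_cast Nat.sub_le _ _))]
  exact coeff_eq_zero_of_degree_lt hP

/-- The Hermitian dual of `GRS_k` has words of weight `k + 1` with prescribed support. -/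
lemma exists_mem_hermDual_grsCode {F : Type*} [Field F] [Fintype F] [Algebra F K]
    (ha : Function.Injective a) (hv : ∀ i, v i ≠ 0) {S : Finset (Fin n)} (hS : S.card = k + 1) :
    ∃ w ∈ hermDual (Fintype.card F) (grsCode k a v), (∀ i ∉ S, w i = 0) ∧ ∀ i ∈ S, w i ≠ 0 := by
  classical
  -- The `q`-th power makes the Hermitian product with a codeword the Frobenius image of a Lagrange
  -- relation.
  let w : Fin n → K := fun i =>
    if i ∈ S then ((∏ j ∈ S.erase i, (a i - a j))⁻¹ / v i) ^ Fintype.card F else 0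
  refine ⟨w, ?_, fun i hi => by simp [w, hi], fun i hi => ?_⟩
  · intro y hy
    obtain ⟨f, hf, hyf⟩ := mem_grsCode.1 hy
    have h1 := sum_eval_div_prod_eq_zero (s := S) (P := f) ha.injOn (by simpa [hS] using hf)
    have h2 := congrArg (FiniteField.frobeniusAlgHom F K) h1
    rw [map_sum, map_zero] at h2
    rw [← h2, hermInner, ← Finset.sum_subset (Finset.subset_univ S)
      (fun i _ hi => by simp [w, hi])]
    refine sum_congr rfl fun i hi => ?_
    rw [FiniteField.frobeniusAlgHom_apply, hyf]
    simp only [w, if_pos hi, ← mul_pow]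
    congr 1
    have := hv i
    field_simp
  · simp only [w, if_pos hi]
    refine pow_ne_zero _ (div_ne_zero (inv_ne_zero (prod_ne_zero_iff.2 fun j hj => ?_)) (hv i))
    exact sub_ne_zero.2 fun h => (ne_of_mem_erase hj) (ha h).symm

theorem exists_quantumMDS_of_grsCode {F : Type*} [Field F] [Fintype F] [Algebra F K] [Fintype K]
    (hK : Fintype.card K = Fintype.card F ^ 2) (hodd : Odd (Fintype.card F))
    (ha : Function.Injective a) (hv : ∀ i, v i ≠ 0) (hkn : 2 * k < n)
    (hself : IsHermSelfOrthogonal (Fintype.card F) (grsCode k a v)) :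
    ∃ Q : Submodule ℂ (QuditSpace F n), IsHermitianConstruction (grsCode k a v) Q ∧
      IsQuantumMDSCode Q (n - 2 * k) (k + 1) := by
  refine exists_quantumMDS_of_hermSelfOrthogonal hK hodd k hself
    (finrank_grsCode ha hv (by omega)) hkn.le
    (fun S hS w hw h0 => eq_zero_of_mem_hermDual_grsCode ha hv Fintype.card_ne_zero hS hw h0) ?_
  obtain ⟨S, -, hS⟩ := Finset.exists_subset_card_eq (s := (univ : Finset (Fin n))) (n := k + 1)
    (by rw [card_univ, Fintype.card_fin]; omega)
  obtain ⟨w, hw, h0, hne⟩ := exists_mem_hermDual_grsCode (F := F) ha hv hS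
  refine ⟨S, hS, w, hw, h0, fun hwC => ?_⟩
  -- The word has `n - k - 1 ≥ k` zeros, by `2k < n`, too many for a nonzero codeword.
  have hw0 := eq_zero_of_mem_grsCode ha hwC hv (S := Sᶜ)
    (by rw [card_compl, hS, Fintype.card_fin]; omega) fun i hi => h0 i (mem_compl.1 hi)
  obtain ⟨i, hi⟩ := card_pos.1 (by omega : 0 < S.card)
  exact hne i hi (congrFun hw0 i)

/-- Self-orthogonality of a code `GRS_k` in terms of power sums. -/
lemma isHermSelfOrthogonal_grsCode {F : Type*} [Field F] [Fintype F] [Algebra F K]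
    (h : ∀ s < k, ∀ t < k,
      ∑ i, v i ^ (Fintype.card F + 1) * a i ^ (s + Fintype.card F * t) = 0) :
    IsHermSelfOrthogonal (Fintype.card F) (grsCode k a v) := by
  rintro x hx y hy
  obtain ⟨f, hf, hxf⟩ := mem_grsCode.1 hx
  obtain ⟨g, hg, hyg⟩ := mem_grsCode.1 hy
  have heval : ∀ p : K[X], p.degree < k → ∀ z, p.eval z = ∑ s ∈ range k, p.coeff s * z ^ s := by
    intro p hp z
    by_cases hp0 : p = 0
    · simp [hp0]
    · exact eval_eq_sum_range' ((natDegree_lt_iff_degree_lt hp0).2 hp) z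
  have hterm : ∀ i, x i * y i ^ Fintype.card F = ∑ s ∈ range k, ∑ t ∈ range k,
      f.coeff s * g.coeff t ^ Fintype.card F *
        (v i ^ (Fintype.card F + 1) * a i ^ (s + Fintype.card F * t)) := by
    intro i
    have hgq : g.eval (a i) ^ Fintype.card F =
        ∑ t ∈ range k, g.coeff t ^ Fintype.card F * a i ^ (Fintype.card F * t) := by
      rw [heval g hg, ← FiniteField.frobeniusAlgHom_apply F K, map_sum]
      refine sum_congr rfl fun t _ => ?_
      rw [FiniteField.frobeniusAlgHom_apply, mul_pow, ← pow_mul, mul_comm t]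
    rw [hxf, hyg, mul_pow, hgq, heval f hf, mul_mul_mul_comm, sum_mul_sum, mul_sum]
    refine sum_congr rfl fun s _ => ?_
    rw [mul_sum]
    exact sum_congr rfl fun t _ => by ring
  rw [hermInner]
  simp only [hterm]
  rw [sum_comm]
  refine sum_eq_zero fun s hs => ?_
  rw [sum_comm]
  refine sum_eq_zero fun t ht => ?_
  rw [← mul_sum, h s (mem_range.1 hs) t (mem_range.1 ht), mul_zero]

end GRS

/-! ### Locators in cosets of a subgroup -/

section Cosets

open Finset

lemma algebraMap_norm_eq_pow_card_add_one {F K : Type*} [Field F] [Fintype F] [Field K] [Fintype K]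
    [Algebra F K] (hK : Fintype.card K = Fintype.card F ^ 2) (x : K) :
    algebraMap F K (Algebra.norm F x) = x ^ (Fintype.card F + 1) := by
  rw [FiniteField.algebraMap_norm_eq_pow, Nat.card_eq_fintype_card, Nat.card_eq_fintype_card, hK]
  congr 1
  have : 1 < Fintype.card F := Fintype.one_lt_card
  have h1 := Nat.sq_sub_sq (Fintype.card F) 1
  rw [one_pow] at h1
  rw [h1, Nat.mul_div_cancel _ (by omega)]

/-- Sum of the powers of a root of unity. -/
lemma sum_pow_eq_ite {R : Type*} [Field R] {x : R} {m : ℕ} (hx : x ^ m = 1) [Decidable (x = 1)] :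
    ∑ ν ∈ range m, x ^ ν = if x = 1 then (m : R) else 0 := by
  split_ifs with h
  · simp [h]
  · rw [geom_sum_eq h, hx, sub_self, zero_div]

variable {F K : Type*} [Field F] [Fintype F] [Field K] [Fintype K] [Algebra F K]

/-- The reduction of the theorem to weights of the cosets. -/
theorem existsQuantumMDSFromGRS_of_weights (hK : Fintype.card K = Fintype.card F ^ 2)
    (hodd : Odd (Fintype.card F)) {θ : Kˣ} {h r m n k : ℕ} (hθ : orderOf θ = 2 * h * m)
    (hcard : Fintype.card F ^ 2 = 2 * h * m + 1) (hn : n = r * m + 1)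
    (hkn : 2 * k < n) (e : Fin r → ℕ) (he : ∀ l l' : Fin r, e l ≡ e l' [MOD 2 * h] → l = l')
    (w : Fin r → F) (hw : ∀ l, w l ≠ 0) (hsum : ∑ l, w l ≠ 0)
    (hT : ∀ s < k, ∀ t < k, ∀ T, T ≠ 0 → s + Fintype.card F * t = m * T →
      ∑ l, algebraMap F K (w l) * ((θ : K) ^ m) ^ (e l * T) = 0) :
    ExistsQuantumMDSFromGRS F θ h r n k := by
  classical
  set q := Fintype.card F with hq
  have hq1 : 1 < q := Fintype.one_lt_card
  have hhm : 0 < 2 * h * m := by nlinarith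
  have hm : 0 < m := Nat.pos_of_ne_zero (by rintro rfl; simp at hhm)
  have hh : 0 < 2 * h := Nat.pos_of_ne_zero (by intro h0; simp [h0] at hhm)
  have hmF : (m : F) ≠ 0 := by
    intro h0
    have h1 : ((q ^ 2 : ℕ) : F) = ((2 * h * m + 1 : ℕ) : F) := by rw [hcard]
    push_cast at h1
    rw [h0, hq, Nat.cast_card_eq_zero] at h1
    simp at h1
  let loc : Option (Fin r × Fin m) → K := fun o =>
    o.elim 0 fun p => (θ : K) ^ e p.1 * ((θ : K) ^ (2 * h)) ^ (p.2 : ℕ)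
  -- The locator `0` contributes only to the exponent `0`; its weight cancels the total of the
  -- others there.
  let wt : Option (Fin r × Fin m) → F := fun o => o.elim (-(m * ∑ l, w l)) fun p => w p.1
  have hwt : ∀ o, wt o ≠ 0 := by
    rintro (_ | p)
    · exact neg_ne_zero.2 (mul_ne_zero hmF hsum)
    · exact hw p.1
  have hloc : Function.Injective loc := by
    rintro (_ | ⟨l, ν⟩) (_ | ⟨l', ν'⟩) hl
    · rfl
    · exact absurd hl.symm (mul_ne_zero (pow_ne_zero _ θ.ne_zero)
        (pow_ne_zero _ (pow_ne_zero _ θ.ne_zero)))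
    · exact absurd hl (mul_ne_zero (pow_ne_zero _ θ.ne_zero)
        (pow_ne_zero _ (pow_ne_zero _ θ.ne_zero)))
    · have h1 : θ ^ (e l + 2 * h * ν) = θ ^ (e l' + 2 * h * ν') := by
        refine Units.ext ?_
        simpa [loc, pow_add, pow_mul] using hl
      rw [pow_eq_pow_iff_modEq, hθ] at h1
      have h2 : e l ≡ e l' [MOD 2 * h] := by
        have h3 := h1.of_mul_right m
        simpa [Nat.ModEq] using h3
      obtain rfl := he l l' h2
      have h4 := Nat.ModEq.add_left_cancel' _ h1
      have h5 := Nat.ModEq.mul_left_cancel' hh.ne' h4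
      rw [Nat.ModEq, Nat.mod_eq_of_lt ν.2, Nat.mod_eq_of_lt ν'.2] at h5
      rw [Fin.ext h5]
  choose nv hnv using FiniteField.norm_surjective F K
  have hnv' : ∀ u, nv u ^ (q + 1) = algebraMap F K u := fun u => by
    rw [hq, ← algebraMap_norm_eq_pow_card_add_one hK, hnv]
  have hcardι : Fintype.card (Option (Fin r × Fin m)) = n := by
    simp [hn]
  let σ : Fin n ≃ Option (Fin r × Fin m) := (Fintype.equivFinOfCardEq hcardι).symm
  have hv0 : ∀ i, nv (wt (σ i)) ≠ 0 := by
    intro i h0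
    have := hnv' (wt (σ i))
    rw [h0, zero_pow (by omega), eq_comm, map_eq_zero] at this
    exact hwt _ this
  have hself : IsHermSelfOrthogonal q (grsCode k (loc ∘ σ) fun i => nv (wt (σ i))) := by
    refine isHermSelfOrthogonal_grsCode fun s hs t ht => ?_
    simp only [← hq, hnv', Function.comp_apply]
    rw [Equiv.sum_comp σ fun o => algebraMap F K (wt o) * loc o ^ (s + q * t),
      Fintype.sum_option, Fintype.sum_prod_type]
    set N := s + q * t with hN
    have hinner : ∀ l : Fin r, ∑ ν : Fin m, algebraMap F K (wt (some (l, ν))) * loc (some (l, ν)) ^ N =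
        algebraMap F K (w l) * (θ : K) ^ (e l * N) *
          if (θ : K) ^ (2 * h * N) = 1 then (m : K) else 0 := by
      intro l
      rw [← sum_pow_eq_ite (x := (θ : K) ^ (2 * h * N)), ← Fin.sum_univ_eq_sum_range, mul_sum]
      · refine sum_congr rfl fun ν _ => ?_
        simp only [wt, loc, Option.elim]
        rw [mul_pow, ← pow_mul, ← pow_mul, ← pow_mul, ← pow_mul]
        rw [mul_right_comm (2 * h), mul_assoc (algebraMap F K (w l)), mul_assoc (2 * h)]
      · rw [← pow_mul, mul_right_comm, pow_mul, ← hθ, ← Units.val_pow_eq_pow_val, pow_orderOf_eq_one,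
          Units.val_one, one_pow]
    simp only [hinner]
    rcases Nat.eq_zero_or_pos N with hN0 | hNpos
    · simp only [hN0, mul_zero, pow_zero, if_true, mul_one, ← sum_mul]
      simp only [wt, Option.elim, map_neg, map_mul, map_sum, map_natCast]
      ring
    · have h0 : loc none ^ N = 0 := zero_pow hNpos.ne'
      rw [h0, mul_zero, zero_add, ← sum_mul]
      split_ifs with h1
      · have h2 : 2 * h * m ∣ 2 * h * N := by
          rw [← hθ]
          refine orderOf_dvd_of_pow_eq_one (Units.ext ?_)
          rw [Units.val_pow_eq_pow_val, h1, Units.val_one]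
        obtain ⟨T, hTN⟩ := Nat.dvd_of_mul_dvd_mul_left hh h2
        have hT0 : T ≠ 0 := by
          rintro rfl
          omega
        have h3 := hT s hs t ht T hT0 hTN
        have h4 : ∑ l, algebraMap F K (w l) * (θ : K) ^ (e l * N) = 0 := by
          rw [← h3]
          refine sum_congr rfl fun l _ => ?_
          rw [hTN, ← pow_mul]
          congr 2
          ring
        rw [h4, zero_mul]
      · rw [mul_zero]
  obtain ⟨Q, hQ, hQ'⟩ := exists_quantumMDS_of_grsCode hK hodd (hloc.comp σ.injective) hv0 hkn hself
  refine ⟨e, loc ∘ σ, fun i => nv (wt (σ i)), Q, he, hloc.comp σ.injective, ?_, hv0, hself, hQ, hQ'⟩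
  rw [σ.surjective.range_comp]
  ext x
  constructor
  · rintro ⟨_ | ⟨l, ν⟩, rfl⟩
    · exact Or.inl rfl
    · exact Or.inr ⟨l, ν, rfl⟩
  · rintro (hx | ⟨l, ν, hx⟩)
    · exact ⟨none, hx.symm⟩
    · refine ⟨some (l, ⟨ν % m, Nat.mod_lt _ hm⟩), ?_⟩
      rw [hx]
      simp only [loc, Option.elim]
      congr 1
      have h1 : θ ^ (2 * h * (ν % m)) = θ ^ (2 * h * ν) := by
        rw [pow_eq_pow_iff_modEq, hθ]
        exact (Nat.mod_modEq ν m).mul_left' (2 * h)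
      have h2 := congrArg Units.val h1
      simpa [pow_mul] using h2

end Cosets

/-! ### Weights of the cosets -/

section Weights

open Finset Polynomial

/-- Weights without zeros that annihilate the powers `1, …, r - 1` of `r` distinct nonzero nodes. -/
lemma exists_weights_of_injective {F : Type*} [Field F] {r : ℕ} (hr : 0 < r) {y : Fin r → F}
    (hy : Function.Injective y) (hy0 : ∀ l, y l ≠ 0) :
    ∃ w : Fin r → F, (∀ l, w l ≠ 0) ∧ ∑ l, w l ≠ 0 ∧
      ∀ S, 0 < S → S < r → ∑ l, w l * y l ^ S = 0 := by
  classical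
  -- The extra node `0` is felt only by the power `0`, where its nonzero Lagrange weight makes `∑ w
  -- l` nonzero.
  let z : Option (Fin r) → F := fun o => o.elim 0 y
  have hz : Function.Injective z := by
    rintro (_ | l) (_ | l') h
    · rfl
    · exact absurd h.symm (hy0 l')
    · exact absurd h (hy0 l)
    · exact congrArg some (hy h)
  let W : Option (Fin r) → F := fun o => (∏ j ∈ univ.erase o, (z o - z j))⁻¹
  have hW : ∀ o, W o ≠ 0 := fun o => inv_ne_zero (prod_ne_zero_iff.2 fun j hj =>
    sub_ne_zero.2 fun h => ne_of_mem_erase hj (hz h).symm)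
  have key : ∀ S < r, W none * 0 ^ S + ∑ l, W (some l) * y l ^ S = 0 := by
    intro S hS
    have h1 := sum_eval_div_prod_eq_zero (s := univ) (y := z) (P := (X : F[X]) ^ S) hz.injOn
      (by
        rw [degree_X_pow, card_univ, Fintype.card_option, Fintype.card_fin, Nat.add_sub_cancel]
        exact_mod_cast hS)
    rw [Fintype.sum_option] at h1
    simp only [eval_pow, eval_X, div_eq_inv_mul] at h1
    exact h1
  refine ⟨fun l => W (some l), fun l => hW _, fun h0 => ?_, fun S hS0 hS => ?_⟩
  · have h1 := key 0 hr
    simp only [pow_zero, mul_one, h0, add_zero] at h1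
    exact hW none h1
  · have h1 := key S hS
    rwa [zero_pow hS0.ne', mul_zero, zero_add] at h1

/-- Weights without zeros on the `2g`-th roots of unity, with prescribed even power sums and
vanishing odd power sums except for one. -/
lemma exists_weights_rootsOfUnity {F : Type*} [Field F] [Fintype F] {g : ℕ} (hg : 0 < g) {ζ : F}
    (hζ : IsPrimitiveRoot ζ (2 * g)) (hgF : ((2 * g : ℕ) : F) ≠ 0) (hcard : 2 * g < Fintype.card F)
    (B : ℕ → F) :
    ∃ w : Fin (2 * g) → F, (∀ i, w i ≠ 0) ∧
      (∀ S, 0 < S → S ≤ g → ∑ i, w i * ζ ^ ((i : ℕ) * (2 * S)) = B S) ∧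
      ∀ S, 2 * S + 2 < 2 * g → ∑ i, w i * ζ ^ ((i : ℕ) * (2 * S + 1)) = 0 := by
  classical
  have horth : ∀ N : ℕ, ∑ i : Fin (2 * g), ζ ^ ((i : ℕ) * N) =
      if 2 * g ∣ N then ((2 * g : ℕ) : F) else 0 := by
    intro N
    have h1 := sum_pow_eq_ite (x := ζ ^ N) (m := 2 * g)
      (by rw [← pow_mul, mul_comm, pow_mul, hζ.pow_eq_one, one_pow])
    rw [← Fin.sum_univ_eq_sum_range] at h1
    simp only [← pow_mul, mul_comm N] at h1
    rw [h1]
    simp only [hζ.pow_eq_one_iff_dvd]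
  -- Inverse Fourier transform on even frequencies: `2j` pairs with `T = 2S` exactly when `j = g -
  -- S`, whence the index `g - j`.
  let E : Fin (2 * g) → F := fun i =>
    ((2 * g : ℕ) : F)⁻¹ * ∑ j ∈ range g, B (g - j) * ζ ^ ((i : ℕ) * (2 * j))
  have hζ0 : ζ ≠ 0 := hζ.ne_zero (by omega)
  -- The term `α ζ^i` affects only `T ≡ -1` modulo `2g`, so `α` is free to avoid the at most `2g`
  -- values that create a zero weight.
  obtain ⟨α, hα⟩ : ∃ α : F, ∀ i : Fin (2 * g), α * ζ ^ (i : ℕ) + E i ≠ 0 := by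
    have h1 : (univ.image fun i : Fin (2 * g) => -E i / ζ ^ (i : ℕ)) ≠ univ := by
      intro h
      have h2 := card_image_le (s := univ) (f := fun i : Fin (2 * g) => -E i / ζ ^ (i : ℕ))
      rw [h, card_univ, card_univ, Fintype.card_fin] at h2
      omega
    obtain ⟨α, hα⟩ : ∃ α, α ∉ univ.image fun i : Fin (2 * g) => -E i / ζ ^ (i : ℕ) := by
      by_contra! h
      exact h1 (eq_univ_iff_forall.2 h)
    refine ⟨α, fun i h => hα (mem_image.2 ⟨i, mem_univ i, ?_⟩)⟩
    rw [div_eq_iff (pow_ne_zero _ hζ0)]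
    linear_combination -h
  have hsum : ∀ T, ∑ i : Fin (2 * g), (α * ζ ^ (i : ℕ) + E i) * ζ ^ ((i : ℕ) * T) =
      α * (if 2 * g ∣ T + 1 then ((2 * g : ℕ) : F) else 0) +
        ∑ j ∈ range g, if 2 * g ∣ T + 2 * j then B (g - j) else 0 := by
    intro T
    have h1 : ∀ j, (if 2 * g ∣ T + 2 * j then B (g - j) else 0) =
        ((2 * g : ℕ) : F)⁻¹ * (B (g - j) * ∑ i : Fin (2 * g), ζ ^ ((i : ℕ) * (T + 2 * j))) := by
      intro j
      rw [horth]
      split_ifs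
      · field_simp
      · simp
    simp only [h1]
    rw [← horth, ← mul_sum]
    simp only [mul_sum, add_mul, sum_add_distrib, E, sum_mul]
    congr 1
    · exact sum_congr rfl fun i _ => by ring
    · rw [sum_comm]
      exact sum_congr rfl fun j _ => sum_congr rfl fun i _ => by ring
  refine ⟨fun i => α * ζ ^ (i : ℕ) + E i, hα, fun S hS0 hS => ?_, fun S hS => ?_⟩
  · rw [hsum, if_neg, mul_zero, zero_add, Finset.sum_eq_single (g - S)]
    · rw [if_pos ⟨1, by omega⟩]
      congr 1
      omega
    · intro j hj hne
      rw [mem_range] at hj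
      refine if_neg fun hd => hne ?_
      have := Nat.eq_of_dvd_of_lt_two_mul (by omega) hd (by omega)
      omega
    · intro hn
      rw [mem_range] at hn
      omega
    · intro hd
      have := (dvd_mul_right 2 g).trans hd
      omega
  · rw [hsum, if_neg, mul_zero, zero_add]
    · refine sum_eq_zero fun j _ => if_neg fun hd => ?_
      have := (dvd_mul_right 2 g).trans hd
      omega
    · intro hd
      have := Nat.le_of_dvd (by omega) hd
      omega

/-- The exponents `T` with `s + q t = m T` for small `s`, `t`. -/
lemma exponent_cases {g c τ ρ s t T : ℕ} (hc : c = 2 * τ + 1) (hρ : ρ < 2 * g)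
    (hs : s ≤ ρ * c + τ) (ht : t ≤ ρ * c + τ)
    (h : s + (2 * g * c + 1) * t = c * (g * c + 1) * T) :
    (∃ S ≤ ρ, T = 2 * S) ∨ (∃ S, S + g < ρ ∧ (T = 2 * S + 1 ∨ T = 2 * S + 1 + 2 * g)) := by
  have hgc : (ρ + 1) * c ≤ 2 * g * c := Nat.mul_le_mul_right c hρ
  have hub : ρ * c + τ < 2 * g * c := by nlinarith
  set q := 2 * g * c + 1 with hq
  have hdig : ∀ s' t', s' < q → s + q * t = s' + q * t' → s = s' ∧ t = t' := by
    intro s' t' hs' heq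
    have h1 : s = s' := by
      have := congrArg (· % q) heq
      simpa [Nat.mod_eq_of_lt hs', Nat.mod_eq_of_lt (show s < q by omega)] using this
    subst h1
    exact ⟨rfl, Nat.eq_of_mul_eq_mul_left (by omega) (Nat.add_left_cancel heq)⟩
  have hlt : ∀ A B, A ≤ B * c + τ → ∀ A', A = A' * c → A' ≤ B := by
    intro A B hA A' hA'
    by_contra! hlt
    have : (B + 1) * c ≤ A' * c := Nat.mul_le_mul_right c hlt
    nlinarith
  rcases Nat.even_or_odd' T with ⟨S, rfl | rfl⟩
  · left
    refine ⟨S, ?_, rfl⟩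
    -- Twice `c(gc + 1)` is `c(q + 1)`, so both base-`q` digits equal `S c`.
    have h1 : s + q * t = S * c + q * (S * c) := by
      rw [h, hq]
      ring
    have h2 : S * c < q := by
      by_contra! h3
      nlinarith
    exact hlt s ρ hs S (hdig _ _ h2 h1).1
  · right
    -- An odd `T` adds `c(gc + 1) = (gc + τ + 1) + qτ`; the low digit may then carry, which produces
    -- the shift of `T` by `2g`.
    have h1 : s + q * t = (S * c + τ + g * c + 1) + q * (S * c + τ) := by
      rw [h, hq, hc]
      ring
    have hA : S * c + τ ≤ ρ * c + τ := by
      by_contra! h3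
      nlinarith
    by_cases hcase : S * c + τ + g * c + 1 < q
    · obtain ⟨h2, h3⟩ := hdig _ _ hcase h1
      refine ⟨S, ?_, Or.inl rfl⟩
      by_contra! h4
      have : ρ * c ≤ (S + g) * c := Nat.mul_le_mul_right c h4
      nlinarith
    · have h5 : g * c ≤ S * c + τ := by
        have : q = 2 * (g * c) + 1 := by rw [hq]; ring
        omega
      have hgS : g ≤ S := hlt (g * c) S h5 g rfl
      obtain ⟨h2, h3⟩ := hdig (S * c + τ - g * c) (S * c + τ + 1) (by omega) (by
        rw [h1]
        have : q = 2 * (g * c) + 1 := by rw [hq]; ring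
        rw [mul_add_one q]
        omega)
      refine ⟨S - g, ?_, Or.inr (by omega)⟩
      by_contra! h4
      have : ρ * c ≤ S * c := Nat.mul_le_mul_right c (by omega)
      omega

end Weights

/-! ### The two ranges of the number of cosets -/

section Ranges

open Finset

lemma IsPrimitiveRoot.pow_half_eq_neg_one {F : Type*} [Field F] {ζ : F} {g : ℕ} (hg : 0 < g)
    (hζ : IsPrimitiveRoot ζ (2 * g)) : ζ ^ g = -1 := by
  have h1 : (ζ ^ g) ^ 2 = 1 := by rw [← pow_mul, mul_comm, hζ.pow_eq_one]
  exact (sq_eq_one_iff.1 h1).resolve_left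
    (hζ.pow_ne_one_of_pos_of_lt hg.ne' (by omega))

variable {F K : Type*} [Field F] [Fintype F] [Field K] [Fintype K] [Algebra F K]
  {g c τ r n k : ℕ} {θ : Kˣ}

/-- As `q + 1 = 2(gc + 1)`, the norm of `θ^c` is the square of `θ^m`. -/
lemma exists_isPrimitiveRoot_algebraMap_eq (hg : 0 < g) (hc : c = 2 * τ + 1)
    (hF : Fintype.card F = 2 * g * c + 1) (hK : Fintype.card K = Fintype.card F ^ 2)
    (hθ : orderOf θ = 2 * (2 * g) * (c * (g * c + 1))) :
    ∃ ζ : F, IsPrimitiveRoot ζ (2 * g) ∧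
      algebraMap F K ζ = ((θ : K) ^ (c * (g * c + 1))) ^ 2 := by
  have h1 : algebraMap F K (Algebra.norm F ((θ : K) ^ c)) = ((θ : K) ^ (c * (g * c + 1))) ^ 2 := by
    rw [algebraMap_norm_eq_pow_card_add_one hK, ← pow_mul, ← pow_mul, hF]
    congr 1
    ring
  refine ⟨_, IsPrimitiveRoot.of_map_of_injective (f := algebraMap F K) ?_
    (algebraMap F K).injective, h1⟩
  rw [h1, ← pow_mul]
  have h2 : IsPrimitiveRoot (θ : K) (2 * (2 * g) * (c * (g * c + 1))) := by
    rw [IsPrimitiveRoot.coe_units_iff, ← hθ]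
    exact IsPrimitiveRoot.orderOf θ
  refine h2.pow (by rw [hc]; positivity) ?_
  ring

/-- With `ρ = g` in `exponent_cases`, odd `T` would need `S + g < g`. The even ones require the
powers `1, …, g` of the nodes `ζ^l` to be annihilated, and `g < r`. -/
lemma existsQuantumMDSFromGRS_of_le (hg : 0 < g) (hc : c = 2 * τ + 1)
    (hF : Fintype.card F = 2 * g * c + 1) (hK : Fintype.card K = Fintype.card F ^ 2)
    (hθ : orderOf θ = 2 * (2 * g) * (c * (g * c + 1))) (hn : n = r * (c * (g * c + 1)) + 1)
    (hkn : 2 * k < n) (hgr : g + 1 ≤ r) (hr : r ≤ 2 * g) (hk : k ≤ g * c + τ + 1) :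
    ExistsQuantumMDSFromGRS F θ (2 * g) r n k := by
  obtain ⟨ζ, hζ, hζω⟩ := exists_isPrimitiveRoot_algebraMap_eq hg hc hF hK hθ
  obtain ⟨w, hw, hsum, hwS⟩ := exists_weights_of_injective (by omega : 0 < r)
    (y := fun l : Fin r => ζ ^ (l : ℕ))
    (fun l l' h => Fin.ext (hζ.pow_inj (by omega) (by omega) h))
    (fun l => pow_ne_zero _ (hζ.ne_zero (by omega)))
  refine existsQuantumMDSFromGRS_of_weights hK ⟨g * c, by rw [hF]; ring⟩ hθ
    (by rw [hF]; ring) hn hkn (fun l => l) ?_ w hw hsum ?_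
  · intro l l' h
    rw [Nat.ModEq, Nat.mod_eq_of_lt (by omega), Nat.mod_eq_of_lt (by omega)] at h
    exact Fin.ext h
  · intro s hs t ht T hT0 hT
    rw [hF] at hT
    rcases exponent_cases hc (by omega : g < 2 * g) (by omega) (by omega) hT with
      ⟨S, hS, rfl⟩ | ⟨S, hS, -⟩
    · have h1 := congrArg (algebraMap F K) (hwS S (by omega) (by omega))
      rw [map_sum, map_zero] at h1
      rw [← h1]
      refine sum_congr rfl fun l _ => ?_
      rw [map_mul, map_pow, map_pow, hζω]
      generalize (θ : K) ^ (c * (g * c + 1)) = ω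
      ring
    · omega

lemma existsQuantumMDSFromGRS_of_lt {ρ : ℕ} (hg : 0 < g) (hc : c = 2 * τ + 1)
    (hF : Fintype.card F = 2 * g * c + 1) (hK : Fintype.card K = Fintype.card F ^ 2)
    (hθ : orderOf θ = 2 * (2 * g) * (c * (g * c + 1)))
    (hn : n = (2 * ρ + 1) * (c * (g * c + 1)) + 1) (hkn : 2 * k < n) (hgρ : g ≤ ρ) (hρ : ρ < 2 * g)
    (hk : k ≤ ρ * c + τ + 1) :
    ExistsQuantumMDSFromGRS F θ (2 * g) (2 * ρ + 1) n k := by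
  obtain ⟨ζ, hζ, hζω⟩ := exists_isPrimitiveRoot_algebraMap_eq hg hc hF hK hθ
  obtain ⟨d, rfl⟩ := Nat.exists_eq_add_of_le hgρ
  have hr : 2 * (g + d) + 1 = 2 * g + (2 * d + 1) := by ring
  have hF0 : ((2 * g * c : ℕ) : F) = -1 := by
    have h1 : ((2 * g * c + 1 : ℕ) : F) = 0 := by rw [← hF, Nat.cast_card_eq_zero]
    push_cast at h1 ⊢
    linear_combination h1
  have hgF : ((2 * g : ℕ) : F) ≠ 0 := by
    intro h0
    rw [Nat.cast_mul, h0, zero_mul] at hF0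
    exact one_ne_zero (neg_eq_zero.1 hF0.symm)
  have h2F : (2 : F) ≠ 0 := by
    intro h0
    rw [Nat.cast_mul, Nat.cast_ofNat, h0, zero_mul] at hgF
    exact hgF rfl
  obtain ⟨u, hu, husum, huS⟩ := exists_weights_of_injective (by omega : 0 < 2 * d + 1)
    (y := fun l : Fin (2 * d + 1) => ζ ^ (l : ℕ))
    (fun l l' h => Fin.ext (hζ.pow_inj (by omega) (by omega) h))
    (fun l => pow_ne_zero _ (hζ.ne_zero (by omega)))
  let U : ℕ → F := fun T => ∑ j, u j * (ζ ^ (j : ℕ)) ^ T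
  have hU : ∀ T, U (T + 2 * g) = U T := by
    intro T
    refine sum_congr rfl fun j _ => ?_
    rw [pow_add (ζ ^ (j : ℕ)), ← pow_mul _ _ (2 * g), mul_comm (j : ℕ) (2 * g), pow_mul ζ (2 * g),
      hζ.pow_eq_one, one_pow, mul_one]
  -- For `T = 2S` one has `ω^T = ζ^S ∈ F`, so `V` can be made to cancel `ω^T U(T)`.
  obtain ⟨v, hv, hvE, hvO⟩ := exists_weights_rootsOfUnity hg hζ hgF
    (by rw [hF, hc]; nlinarith) (fun S => -(ζ ^ S * U (2 * S)))
  let V : ℕ → F := fun T => ∑ i, v i * ζ ^ ((i : ℕ) * T)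
  have hV : ∀ T, V (T + 2 * g) = V T := by
    intro T
    refine sum_congr rfl fun i _ => ?_
    rw [mul_add, pow_add, mul_comm (i : ℕ) (2 * g), pow_mul ζ (2 * g), hζ.pow_eq_one, one_pow,
      mul_one]
  let e : Fin (2 * g) ⊕ Fin (2 * d + 1) → ℕ := Sum.elim (fun i => 2 * i) (fun j => 2 * j + 1)
  let w : Fin (2 * g) ⊕ Fin (2 * d + 1) → F := Sum.elim v u
  let σ : Fin (2 * (g + d) + 1) ≃ Fin (2 * g) ⊕ Fin (2 * d + 1) :=
    (finCongr hr).trans finSumFinEquiv.symm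
  have htotal : ∀ T, ∑ l, algebraMap F K (w (σ l)) *
      ((θ : K) ^ (c * (g * c + 1))) ^ (e (σ l) * T) =
        algebraMap F K (V T) + ((θ : K) ^ (c * (g * c + 1))) ^ T * algebraMap F K (U T) := by
    intro T
    rw [Equiv.sum_comp σ fun o => algebraMap F K (w o) *
      ((θ : K) ^ (c * (g * c + 1))) ^ (e o * T), Fintype.sum_sum_type]
    simp only [w, e, Sum.elim_inl, Sum.elim_inr, V, U, map_sum, mul_sum, map_mul, map_pow, hζω]
    congr 1
    · exact sum_congr rfl fun i _ => by ring
    · exact sum_congr rfl fun i _ => by ring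
  have hzero : ∀ S, 0 < S → S < 2 * d + 1 → U S = 0 := huS
  refine existsQuantumMDSFromGRS_of_weights hK ⟨g * c, by rw [hF]; ring⟩ hθ
    (by rw [hF]; ring) hn hkn (e ∘ σ) ?_ (w ∘ σ) ?_ ?_ ?_
  · intro l l' h
    have heinj : Function.Injective e := by
      rintro (i | i) (j | j) hij <;> simp only [e, Sum.elim_inl, Sum.elim_inr] at hij
      · exact congrArg _ (Fin.ext (by omega))
      · omega
      · omega
      · exact congrArg _ (Fin.ext (by omega))
    have hlt : ∀ o, e o < 2 * (2 * g) := by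
      rintro (i | j)
      · simp only [e, Sum.elim_inl]
        omega
      · simp only [e, Sum.elim_inr]
        omega
    change e (σ l) % _ = e (σ l') % _ at h
    rw [Nat.mod_eq_of_lt (hlt (σ l)), Nat.mod_eq_of_lt (hlt (σ l'))] at h
    exact σ.injective (heinj h)
  · intro l
    simp only [Function.comp_apply]
    rcases σ l with i | j
    · exact hv i
    · exact hu j
  -- The prescription at `S = g` reads `V(2g) = -ζ^g U(2g)`, with `ζ^g = -1` and period `2g`; so the
  -- total weight is `2 U(0)`, not zero.
  · have h1 : V 0 = U 0 := by
      rw [← hV, zero_add]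
      refine (hvE g hg le_rfl).trans ?_
      rw [hζ.pow_half_eq_neg_one hg, ← zero_add (2 * g), hU]
      ring
    have h2 : ∑ l, (w ∘ σ) l = V 0 + U 0 := by
      have := Equiv.sum_comp σ w
      simp only [Function.comp_apply, this, Fintype.sum_sum_type]
      simp [w, V, U]
    have h3 : U 0 ≠ 0 := by simpa [U] using husum
    rw [h2, h1, ← two_mul]
    exact mul_ne_zero h2F h3
  · intro s hs t ht T hT0 hT
    rw [hF] at hT
    refine (htotal T).trans ?_
    rcases exponent_cases hc hρ (by omega) (by omega) hT with ⟨S, hS, rfl⟩ | ⟨S, hS, hTS⟩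
    · rcases Nat.lt_or_ge g S with hgS | hSg
      -- Beyond `g`, periodicity returns to an exponent `2(S' + 1) ≤ 2d`, where `U` vanishes, and
      -- with it `V`.
      · obtain ⟨S', rfl⟩ := Nat.exists_eq_add_of_lt hgS
        have h0 : U (2 * (S' + 1)) = 0 := hzero _ (by omega) (by omega)
        have h1 : V (2 * (S' + 1)) = 0 := by
          refine (hvE (S' + 1) (by omega) (by omega)).trans ?_
          rw [h0, mul_zero, neg_zero]
        rw [show 2 * (g + S' + 1) = 2 * (S' + 1) + 2 * g by ring, hU, hV, h0, h1]
        simp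
      · have h1 : V (2 * S) = -(ζ ^ S * U (2 * S)) := hvE S (by omega) hSg
        rw [h1, pow_mul, ← hζω, map_neg, map_mul, map_pow]
        ring
    -- For odd `T`, `V` and `U` are made to vanish separately. Here `S < d < g`, so the exceptional
    -- frequency `2g - 1` is not reached.
    · have h0 : U (2 * S + 1) = 0 := hzero _ (by omega) (by omega)
      have h1 : V (2 * S + 1) = 0 := hvO S (by omega)
      rcases hTS with rfl | rfl
      · rw [h0, h1]
        simp
      · rw [hU, hV, h0, h1]
        simp

end Ranges

theorem theorem3p2 {F K : Type*} [Field F] [Fintype F] [Field K] [Fintype K] [Algebra F K]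
    (q h τ r n k : ℕ) (hF : Fintype.card F = q) (hK : Fintype.card K = q ^ 2)
    (θ : Kˣ) (hθ : ∀ x : Kˣ, x ∈ Subgroup.zpowers θ)
    (hq : Odd q) (hh : Even h) (hτ : 1 ≤ τ)
    (hqh : ((q : ℚ) - 1) / h = 2 * τ + 1)
    (hn : (n : ℚ) = r * ((q : ℚ) ^ 2 - 1) / (2 * h) + 1) :
    ((h : ℚ) / 2 + 1 ≤ r → r ≤ h →
      1 ≤ k → (k : ℚ) ≤ (h + 1) * ((q - 1) / (2 * h)) + 1 / 2 →
      ExistsQuantumMDSFromGRS F θ h r n k) ∧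
    (Odd r → h < r → r < 2 * h →
      1 ≤ k → (k : ℚ) ≤ r * ((q - 1) / (2 * h)) + 1 / 2 →
      ExistsQuantumMDSFromGRS F θ h r n k) := by
  obtain ⟨g, rfl⟩ := hh.exists_two_nsmul
  rw [smul_eq_mul] at *
  obtain ⟨c, hc⟩ : ∃ c, c = 2 * τ + 1 := ⟨_, rfl⟩
  have hcQ : (c : ℚ) = 2 * τ + 1 := by rw [hc]; push_cast; ring
  rw [← hcQ] at hqh
  have hg : 0 < g := by
    rcases Nat.eq_zero_or_pos g with rfl | h0
    · rw [hc] at hqh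
      push_cast at hqh
      -- For `g = 0` the quotient is `0` by convention, but `2τ + 1` is positive.
      rw [div_zero] at hqh
      linarith [(Nat.cast_nonneg τ : (0 : ℚ) ≤ τ)]
    · exact h0
  have hgQ : (g : ℚ) ≠ 0 := Nat.cast_ne_zero.2 hg.ne'
  have hqQ : (q : ℚ) = 2 * g * c + 1 := by
    push_cast at hqh
    field_simp at hqh
    linear_combination hqh
  have hqN : q = 2 * g * c + 1 := by exact_mod_cast hqQ
  have hnN : n = r * (c * (g * c + 1)) + 1 := by
    have h1 : (n : ℚ) = r * (c * (g * c + 1)) + 1 := by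
      rw [hn, hqQ]
      push_cast
      field_simp
      ring
    exact_mod_cast h1
  have hhalf : ((q : ℚ) - 1) / (2 * ((2 * g : ℕ) : ℚ)) = c / 2 := by
    rw [hqQ]
    push_cast
    field_simp
    ring
  have hKF : Fintype.card K = Fintype.card F ^ 2 := by rw [hK, hF]
  have hF' : Fintype.card F = 2 * g * c + 1 := by rw [hF, hqN]
  have hord : orderOf θ = 2 * (2 * g) * (c * (g * c + 1)) := by
    rw [orderOf_eq_card_of_forall_mem_zpowers hθ, Nat.card_units, Nat.card_eq_fintype_card, hK, hqN]
    refine Nat.sub_eq_of_eq_add ?_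
    ring
  have hgc : g * c ≥ c := Nat.le_mul_of_pos_left c hg
  have hc3 : 3 ≤ c := by omega
  rw [hhalf]
  constructor
  · intro h1 h2 _ hk
    have hgr : g + 1 ≤ r := by
      push_cast at h1
      have : (g : ℚ) + 1 ≤ r := by linarith
      exact_mod_cast this
    have hk' : k ≤ g * c + τ + 1 := by
      push_cast at hk
      have : (k : ℚ) ≤ g * c + τ + 1 := by nlinarith
      exact_mod_cast this
    refine existsQuantumMDSFromGRS_of_le hg hc hF' hKF hord hnN ?_ hgr h2 hk'
    have h3 : 2 * (c * (g * c + 1)) ≤ r * (c * (g * c + 1)) :=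
      Nat.mul_le_mul_right _ (by omega)
    have h4 : 3 * (g * c + 1) ≤ c * (g * c + 1) := Nat.mul_le_mul_right _ hc3
    omega
  · rintro ⟨ρ, rfl⟩ h1 h2 _ hk
    have hk' : k ≤ ρ * c + τ + 1 := by
      push_cast at hk
      have : (k : ℚ) ≤ ρ * c + τ + 1 := by nlinarith
      exact_mod_cast this
    refine existsQuantumMDSFromGRS_of_lt hg hc hF' hKF hord hnN ?_ (by omega) (by omega) hk'
    have h3 : (2 * ρ + 1) * (c * 4) ≤ (2 * ρ + 1) * (c * (g * c + 1)) :=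
      Nat.mul_le_mul_left _ (Nat.mul_le_mul_left _ (by omega))
    nlinarith
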